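/- For $k\ge 0$, the $k$-dimensional generalized diamond graph $D_k$ has as vertices the points $x\in\mathbb Z^{k+1}$ with $\sum_i x_i\in\{0,1\}$, two points being adjacent when they are at unit distance. A graph $G$ is an isometric diamond subgraph if for some $k$ it embeds isometrically into $D_k$, that is, if there is a map of the vertices of $G$ to those of $D_k$ that preserves graph distances; the least such $k$ is the diamond dimension of $G$. The Djokovic–Winkler relation on the edges of $G$ is defined by $(p,q)\sim(r,s)$ if and only if $d(p,r)+d(p,s)=d(q,r)+d(q,s)$. Theorem. Let $G$ be an isometric diamond subgraph with at least two vertices. Then $G$ is bipartite. Color it properly with black and white. For each edge there is exactly one set $C$ of vertices such that the edges spanning the cut $(C,V\setminus C)$ are exactly the edges related to the given one under $\sim$, and such that $C$ contains the white endpoints, and $V\setminus C$ the black endpoints, of all these edges. Partially order the cuts obtained in this way by inclusion of their white sides: $(C,V\setminus C)\le(C',V\setminus C')$ if and only if $C\subseteq C'$. Then the diamond dimension of $G$, plus one, equals the width (the maximum size of an antichain) of this partial order. Moreover, there are algorithms that run in time polynomial in the size of the input and that (i) decide, for a finite graph $G$ and a number $k\ge 0$, whether $G$ embeds isometrically into $D_k$;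 (ii) decide whether a finite graph $G$ is an isometric diamond subgraph and, if it is, compute its diamond dimension $d$ and an isometric embedding of $G$ into $D_d$. -/

import Mathlib

namespace Diamond

/-! ### Generalized diamond graphs and isometric embeddings -/

/-- The points of the `k`-dimensional generalized diamond, labelled by their `k + 1` integer
coordinates: the integer points whose coordinate sum is zero or one. -/
abbrev Vertex (k : ℕ) : Type :=
  {x : Fin (k + 1) → ℤ // ∑ i, x i = 0 ∨ ∑ i, x i = 1}

/-- The `k`-dimensional generalized diamond graph: two points are adjacent when they are at unit
distance.  (For integer points, the `L₁` and the Euclidean distance are equal to one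
simultaneously.) -/
def graph (k : ℕ) : SimpleGraph (Vertex k) where
  Adj x y := ∑ i, |x.1 i - y.1 i| = 1
  symm := by
    refine ⟨fun x y h => ?_⟩
    simpa only [abs_sub_comm] using h
  loopless := by
    refine ⟨fun x h => ?_⟩
    simp at h

/-- `f` preserves the graph distance.  The extended distance is used, which is infinite between
different components. -/
def IsIsometricEmbedding {V W : Type*} (G : SimpleGraph V) (H : SimpleGraph W) (f : V → W) :
    Prop :=
  ∀ u v, H.edist (f u) (f v) = G.edist u v

/-- `G` embeds isometrically into the `k`-dimensional generalized diamond graph. -/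
def Embeds {V : Type*} (G : SimpleGraph V) (k : ℕ) : Prop :=
  ∃ f : V → Vertex k, IsIsometricEmbedding G (graph k) f

/-- `G` is an isometric diamond subgraph. -/
def IsIsometricDiamondSubgraph {V : Type*} (G : SimpleGraph V) : Prop :=
  ∃ k, Embeds G k

/-- The diamond dimension: the least `k` such that `G` embeds isometrically into the
`k`-dimensional generalized diamond graph.  It is used for isometric diamond subgraphs only, for
which the set of these `k` is nonempty. -/
noncomputable def dimension {V : Type*} (G : SimpleGraph V) : ℕ :=
  sInf {k | Embeds G k}

/-! ### Djokovic–Winkler cuts and their partial order -/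

/-- The Djokovic–Winkler relation between the edges `pq` and `rs`. -/
def DWRel {V : Type*} (G : SimpleGraph V) (p q r s : V) : Prop :=
  G.dist p r + G.dist p s = G.dist q r + G.dist q s

/-- The edge `rs` spans the cut `(C, Cᶜ)`. -/
def Spans {V : Type*} (C : Set V) (r s : V) : Prop :=
  (r ∈ C ∧ s ∉ C) ∨ (s ∈ C ∧ r ∉ C)

/-- `(C, Cᶜ)` is the cut formed by the Djokovic–Winkler class of the edge `pq` (the edges spanning
it are exactly those of the class), and `C` contains the white endpoints of the spanning edges, while
`Cᶜ` contains the black ones.  The colour `true` is white. -/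
def IsWhiteSide {V : Type*} (G : SimpleGraph V) (c : G.Coloring Bool) (p q : V) (C : Set V) :
    Prop :=
  (∀ r s, G.Adj r s → (Spans C r s ↔ DWRel G p q r s)) ∧
    ∀ r s, G.Adj r s → r ∈ C → s ∉ C → c r = true ∧ c s = false

/-- The Djokovic–Winkler cuts of `G`, each represented by its white side.  They are partially
ordered by inclusion. -/
def cuts {V : Type*} (G : SimpleGraph V) (c : G.Coloring Bool) : Set (Set V) :=
  {C | ∃ p q, G.Adj p q ∧ IsWhiteSide G c p q C}

/-- The width of a partial order: the maximum size of an antichain. -/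
noncomputable def width (α : Type*) [PartialOrder α] : ℕ∞ :=
  ⨆ A : {A : Set α // IsAntichain (· ≤ ·) A}, A.1.encard

/-! ### A random access machine with a step count

The memory consists of integer arrays with two integer indices.  The operations are addition and
subtraction of integers, comparison, and indirect reading and writing; there is no multiplication, so
that the bit length of the numbers that occur grows at most linearly with the number of steps, and
a polynomial number of steps means polynomial time in the usual sense. -/

/-- The memory: `σ a i j` is the entry `(i, j)` of the array number `a`. -/
abbrev Memory : Type := ℕ → ℤ → ℤ → ℤ

/-- Expressions. -/
inductive Expr : Type
  | const (z : ℤ)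
  | read (a : ℕ) (i j : Expr)
  | add (x y : Expr)
  | sub (x y : Expr)

/-- The value of an expression. -/
def Expr.eval (σ : Memory) : Expr → ℤ
  | .const z => z
  | .read a i j => σ a (i.eval σ) (j.eval σ)
  | .add x y => x.eval σ + y.eval σ
  | .sub x y => x.eval σ - y.eval σ

/-- The number of steps in which an expression is evaluated. -/
def Expr.cost : Expr → ℕ
  | .const _ => 1
  | .read _ i j => i.cost + j.cost + 1
  | .add x y => x.cost + y.cost + 1
  | .sub x y => x.cost + y.cost + 1

/-- Programs: `write a i j e` assigns `e` to the entry `(i, j)` of the array `a`, `ite x y P Q` is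
"if `x < y` then `P` else `Q`", and `loop x y P` is "while `x < y` do `P`". -/
inductive Program : Type
  | skip
  | write (a : ℕ) (i j e : Expr)
  | seq (P Q : Program)
  | ite (x y : Expr) (P Q : Program)
  | loop (x y : Expr) (P : Program)

/-- The memory after the assignment of `z` to the entry `(i, j)` of the array `a`. -/
def Memory.set (σ : Memory) (a : ℕ) (i j z : ℤ) : Memory :=
  fun a' i' j' => if a' = a ∧ i' = i ∧ j' = j then z else σ a' i' j'

/-- `Runs P σ τ t`: started in the memory `σ`, the program `P` halts after exactly `t` steps, with
the memory `τ`. -/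
inductive Runs : Program → Memory → Memory → ℕ → Prop
  | skip (σ : Memory) : Runs .skip σ σ 1
  | write (σ : Memory) (a : ℕ) (i j e : Expr) :
      Runs (.write a i j e) σ (σ.set a (i.eval σ) (j.eval σ) (e.eval σ))
        (i.cost + j.cost + e.cost + 1)
  | seq {P Q : Program} {σ τ υ : Memory} {s t : ℕ} :
      Runs P σ τ s → Runs Q τ υ t → Runs (.seq P Q) σ υ (s + t)
  | ite_true {x y : Expr} {P Q : Program} {σ τ : Memory} {t : ℕ} :
      x.eval σ < y.eval σ → Runs P σ τ t → Runs (.ite x y P Q) σ τ (x.cost + y.cost + 1 + t)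
  | ite_false {x y : Expr} {P Q : Program} {σ τ : Memory} {t : ℕ} :
      ¬ x.eval σ < y.eval σ → Runs Q σ τ t → Runs (.ite x y P Q) σ τ (x.cost + y.cost + 1 + t)
  | loop_true {x y : Expr} {P : Program} {σ τ υ : Memory} {s t : ℕ} :
      x.eval σ < y.eval σ → Runs P σ τ s → Runs (.loop x y P) τ υ t →
        Runs (.loop x y P) σ υ (x.cost + y.cost + 1 + s + t)
  | loop_false {x y : Expr} {P : Program} {σ : Memory} :
      ¬ x.eval σ < y.eval σ → Runs (.loop x y P) σ σ (x.cost + y.cost + 1)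

open Classical in
/-- The initial memory for a graph `G` on `n` vertices and a number `k`: the entry `(0, 0)` of the
array `0` is `n`, the entry `(0, 0)` of the array `1` is `k`, the array `2` is the adjacency matrix
of `G`, and all other entries are zero. -/
noncomputable def input {n : ℕ} (G : SimpleGraph (Fin n)) (k : ℕ) : Memory :=
  fun a i j =>
    if a = 0 ∧ i = 0 ∧ j = 0 then (n : ℤ)
    else if a = 1 ∧ i = 0 ∧ j = 0 then (k : ℤ)
    else if a = 2 ∧ ∃ u v : Fin n, i = (u : ℕ) ∧ j = (v : ℕ) ∧ G.Adj u v then 1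
    else 0

/-- Whether a finite graph embeds isometrically into the generalized diamond graph of a given
dimension can be decided in polynomial time.  The answer (one or zero) is the entry `(0, 0)` of the
array `0`. -/
def PolyTimeTest : Prop :=
  ∃ (P : Program) (b : Polynomial ℕ), ∀ (n k : ℕ) (G : SimpleGraph (Fin n)),
    ∃ (τ : Memory) (t : ℕ), Runs P (input G k) τ t ∧ t ≤ b.eval n ∧
      (Embeds G k → τ 0 0 0 = 1) ∧ (¬ Embeds G k → τ 0 0 0 = 0)

/-- Isometric diamond subgraphs can be recognized, and embedded isometrically into a generalized
diamond graph of minimum dimension, in polynomial time.  The entry `(0, 0)` of the array `0` tells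
whether the graph is an isometric diamond subgraph; if it is, then the entry `(0, 0)` of the array
`1` is the diamond dimension, and row `v` of the array `2` holds the coordinates of the point at
which the vertex `v` is placed. -/
def PolyTimeEmbedding : Prop :=
  ∃ (P : Program) (b : Polynomial ℕ), ∀ (n : ℕ) (G : SimpleGraph (Fin n)),
    ∃ (τ : Memory) (t : ℕ), Runs P (input G 0) τ t ∧ t ≤ b.eval n ∧
      (¬ IsIsometricDiamondSubgraph G → τ 0 0 0 = 0) ∧
      (IsIsometricDiamondSubgraph G →
        τ 0 0 0 = 1 ∧ τ 1 0 0 = (dimension G : ℤ) ∧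
        ∃ f : Fin n → Vertex (dimension G), IsIsometricEmbedding G (graph (dimension G)) f ∧
          ∀ (v : Fin n) (i : Fin (dimension G + 1)), τ 2 ((v : ℕ) : ℤ) ((i : ℕ) : ℤ) = (f v).1 i)

end Diamond

namespace Diamond

/-! ### Distances in the generalized diamond graph -/

/-! In `graph k` the distance is the L₁ distance, and an edge changes a single coordinate `i`, from
`t` at its white end (coordinate sum one) to `t - 1` at its black end. If `G` is placed
isometrically, a vertex is nearer to the white end exactly when its coordinate `i` is at least `t`.
So each Djokovic–Winkler class cuts `G` at a threshold of one coordinate, with the white side above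
(`IsPlacement.mem_side`, `IsPlacement.hasColoredCuts`). Thresholds of one coordinate are nested, so
an antichain of cuts has at most one member per coordinate (`IsPlacement.width_le`).

Conversely, let the cuts be distributed among chains, and let coordinate `j` of `v` be the signed
number of cuts of chain `j` that separate `v` from a fixed black vertex. Two vertices are separated
by as many cuts as their distance (`HasColoredCuts.exists_finset_separating`), and those of one
chain are crossed in the same direction, so the L₁ distance is the graph distance. An edge crosses
only one cut, so the sums are zero and one (`HasColoredCuts.isPlacement_chainCoord`). Dilworth's
theorem provides as many chains as the width; a selection principle extends it to infinite `G`
(`exists_chains_of_width_le`).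

The finite case of Dilworth's theorem is proved by an auction. A chain decomposition is a matching
of elements with larger ones; when no bid is possible any more, a gap between the prices exhibits an
antichain with at least as many elements as there are chains
(`AuctionState.Invariant.exists_antichain`).

The algorithm computes distances, reads off the cuts of the edges of a breadth-first tree, runs the
same auction on them and compares the resulting coordinates with all distances. This comparison
makes positive answers right for every graph (`Result.isPlacement_of_ok`); for isometric diamond
subgraphs the theory guarantees success with the least number of chains
(`Result.ok_of_isIsometricDiamondSubgraph`). It is written as a matrix program, whose loops are all
bounded by the number of vertices, and compiled to the machine (`MProgram.reaches_compile`). -/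

theorem exists_eq_single_of_sum_eq_one {ι : Type*} [Fintype ι] [DecidableEq ι] (d : ι → ℤ)
    (h0 : ∀ i, 0 ≤ d i) (h1 : ∑ i, d i = 1) : ∃ i, ∀ j, d j = if j = i then 1 else 0 := by
  obtain ⟨i, hi⟩ : ∃ i, d i ≠ 0 := by
    by_contra! h
    simp [h] at h1
  have hs := Finset.add_sum_erase Finset.univ d (Finset.mem_univ i)
  have hn : 0 ≤ ∑ j ∈ Finset.univ.erase i, d j := Finset.sum_nonneg fun j _ => h0 j
  have hi0 := h0 i
  have hz : ∑ j ∈ Finset.univ.erase i, d j = 0 := by omega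
  rw [Finset.sum_eq_zero_iff_of_nonneg fun j _ => h0 j] at hz
  refine ⟨i, fun j => ?_⟩
  split_ifs with hj
  · subst hj
    have : ∑ j' ∈ Finset.univ.erase j, d j' = 0 := Finset.sum_eq_zero hz
    omega
  · exact hz j (by simp [hj])

/-- From a point of sum zero one raises a coordinate that is below its target, from a point of sum
one one lowers a coordinate that is above. Since the sum of the target is zero or one, such a
coordinate exists until the target is reached. -/
theorem exists_walk_length_eq {k : ℕ} (n : ℕ) (x y : Vertex k)
    (h : ∑ i, |x.1 i - y.1 i| = n) : ∃ p : (graph k).Walk x y, p.length = n := by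
  induction n generalizing x with
  | zero =>
    have hxy : x = y := by
      ext i
      have := (Finset.sum_eq_zero_iff_of_nonneg fun i _ => abs_nonneg _).1 h i (Finset.mem_univ i)
      rw [abs_eq_zero] at this
      omega
    subst hxy
    exact ⟨.nil, rfl⟩
  | succ n ih =>
    have step (i : Fin (k + 1)) (e : ℤ) (he : |e| = 1)
        (hs : ∑ j, x.1 j + e = 0 ∨ ∑ j, x.1 j + e = 1)
        (hi : |x.1 i + e - y.1 i| = |x.1 i - y.1 i| - 1) :
        ∃ p : (graph k).Walk x y, p.length = n + 1 := by
      have hsum : ∑ j, (x.1 j + if j = i then e else 0) = ∑ j, x.1 j + e := by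
        simp [Finset.sum_add_distrib]
      let z : Vertex k := ⟨fun j => x.1 j + if j = i then e else 0, by rw [hsum]; exact hs⟩
      have hadj : (graph k).Adj x z := by
        change ∑ j, |x.1 j - (x.1 j + if j = i then e else 0)| = 1
        have : ∀ j, |x.1 j - (x.1 j + if j = i then e else 0)| = if j = i then 1 else 0 := by
          intro j
          split_ifs <;> simp [he]
        simp only [this]
        simp
      have hz : ∑ j, |z.1 j - y.1 j| = n := by
        have : ∀ j, |z.1 j - y.1 j| = |x.1 j - y.1 j| - if j = i then 1 else 0 := by
          intro j
          change |x.1 j + (if j = i then e else 0) - y.1 j| = _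
          split_ifs with hj
          · subst hj; exact hi
          · simp
        simp only [this, Finset.sum_sub_distrib, h]
        simp
      obtain ⟨p, hp⟩ := ih z hz
      exact ⟨.cons hadj p, by simp [hp]⟩
    have hne : ¬ ∀ i, x.1 i = y.1 i := by
      intro hxy
      simp [hxy] at h
      omega
    rcases x.2 with hx | hx
    · obtain ⟨i, hi⟩ : ∃ i, x.1 i < y.1 i := by
        by_contra! hle
        have hs : ∑ i, (x.1 i - y.1 i) = 0 := by
          have : 0 ≤ ∑ i, (x.1 i - y.1 i) := Finset.sum_nonneg fun i _ => by
            have := hle i; omega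
          rw [Finset.sum_sub_distrib] at this ⊢
          rcases y.2 with hy | hy <;> omega
        rw [Finset.sum_eq_zero_iff_of_nonneg fun i _ => by have := hle i; omega] at hs
        exact hne fun i => by have := hs i (Finset.mem_univ i); omega
      refine step i 1 (by simp) (by omega) ?_
      rw [abs_of_nonpos (by omega), abs_of_nonpos (by omega)]
      ring
    · obtain ⟨i, hi⟩ : ∃ i, y.1 i < x.1 i := by
        by_contra! hle
        have hs : ∑ i, (y.1 i - x.1 i) = 0 := by
          have : 0 ≤ ∑ i, (y.1 i - x.1 i) := Finset.sum_nonneg fun i _ => by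
            have := hle i; omega
          rw [Finset.sum_sub_distrib] at this ⊢
          rcases y.2 with hy | hy <;> omega
        rw [Finset.sum_eq_zero_iff_of_nonneg fun i _ => by have := hle i; omega] at hs
        exact hne fun i => by have := hs i (Finset.mem_univ i); omega
      refine step i (-1) (by simp) (by omega) ?_
      rw [abs_of_nonneg (by omega), abs_of_nonneg (by omega)]
      ring

theorem sum_abs_sub_le_length {k : ℕ} {x y : Vertex k} (p : (graph k).Walk x y) :
    ∑ i, |x.1 i - y.1 i| ≤ p.length := by
  induction p with
  | nil => simp
  | @cons x z y h p ih =>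
    have hxz : ∑ i, |x.1 i - z.1 i| = 1 := h
    have := Finset.sum_le_sum fun i (_ : i ∈ Finset.univ) => abs_sub_le (x.1 i) (z.1 i) (y.1 i)
    rw [Finset.sum_add_distrib] at this
    push_cast [SimpleGraph.Walk.length_cons]
    omega

theorem graph_reachable {k : ℕ} (x y : Vertex k) : (graph k).Reachable x y := by
  have h0 : 0 ≤ ∑ i, |x.1 i - y.1 i| := Finset.sum_nonneg fun i _ => abs_nonneg _
  exact (exists_walk_length_eq _ x y (Int.toNat_of_nonneg h0).symm).choose.reachable

theorem graph_dist {k : ℕ} (x y : Vertex k) :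
    ((graph k).dist x y : ℤ) = ∑ i, |x.1 i - y.1 i| := by
  have h0 : 0 ≤ ∑ i, |x.1 i - y.1 i| := Finset.sum_nonneg fun i _ => abs_nonneg _
  obtain ⟨p, hp⟩ := exists_walk_length_eq _ x y (Int.toNat_of_nonneg h0).symm
  obtain ⟨q, hq⟩ := (graph_reachable x y).exists_walk_length_eq_dist
  have h1 := SimpleGraph.dist_le p
  have h2 := sum_abs_sub_le_length q
  omega

/-! ### Coordinates of an isometric diamond subgraph -/

/-- The map `f` places the vertices of `G` isometrically into the generalized diamond with
coordinates indexed by `ι`, the white vertices having coordinate sum one. -/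
structure IsPlacement {V ι : Type*} [Fintype ι] (G : SimpleGraph V) (c : V → Bool)
    (f : V → ι → ℤ) : Prop where
  reachable : ∀ u v, G.Reachable u v
  dist_eq : ∀ u v, (G.dist u v : ℤ) = ∑ i, |f u i - f v i|
  sum_eq : ∀ v, ∑ i, f v i = if c v then 1 else 0

theorem IsPlacement.isIsometricEmbedding {V : Type*} {k : ℕ} {G : SimpleGraph V} {c : V → Bool}
    {f : V → Fin (k + 1) → ℤ} (h : IsPlacement G c f) (g : V → Vertex k)
    (hg : ∀ v i, (g v).1 i = f v i) : IsIsometricEmbedding G (graph k) g := by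
  intro u v
  rw [← (graph_reachable _ _).coe_dist_eq_edist, ← (h.reachable u v).coe_dist_eq_edist]
  have h1 := graph_dist (g u) (g v)
  have h2 := h.dist_eq u v
  simp only [hg] at h1
  norm_cast
  omega

theorem IsPlacement.embeds {V : Type*} {k : ℕ} {G : SimpleGraph V} {c : V → Bool}
    {f : V → Fin (k + 1) → ℤ} (h : IsPlacement G c f) : Embeds G k :=
  ⟨fun v => ⟨f v, by rw [h.sum_eq]; split_ifs <;> simp⟩, h.isIsometricEmbedding _ fun _ _ => rfl⟩

theorem reachable_of_embeds {V : Type*} {k : ℕ} {G : SimpleGraph V} (h : Embeds G k) (u v : V) :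
    G.Reachable u v := by
  obtain ⟨f, hf⟩ := h
  rw [← SimpleGraph.edist_ne_top_iff_reachable, ← hf,
    SimpleGraph.edist_ne_top_iff_reachable]
  exact graph_reachable _ _

theorem dist_eq_of_isIsometricEmbedding {V : Type*} {k : ℕ} {G : SimpleGraph V} {f : V → Vertex k}
    (hf : IsIsometricEmbedding G (graph k) f) (u v : V) :
    (G.dist u v : ℤ) = ∑ i, |(f u).1 i - (f v).1 i| := by
  rw [← graph_dist, SimpleGraph.dist, SimpleGraph.dist, hf]

/-- The sum of the absolute differences has the parity of the sum of the differences, and one is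
odd. -/
theorem sum_ne_of_adj {V : Type*} {k : ℕ} {G : SimpleGraph V} {f : V → Vertex k}
    (hf : IsIsometricEmbedding G (graph k) f) {u v : V} (h : G.Adj u v) :
    ∑ i, (f u).1 i ≠ ∑ i, (f v).1 i := by
  intro he
  have h1 := dist_eq_of_isIsometricEmbedding hf u v
  rw [SimpleGraph.dist_eq_one_iff_adj.2 h] at h1
  have h2 : ∑ i, ((f u).1 i - (f v).1 i) = 0 := by rw [Finset.sum_sub_distrib]; omega
  have h3 : Even (∑ i, (|(f u).1 i - (f v).1 i| - ((f u).1 i - (f v).1 i))) := by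
    refine Finset.even_sum _ fun i _ => ?_
    rcases abs_choice ((f u).1 i - (f v).1 i) with h | h <;> rw [h]
    · simp
    · exact ⟨-((f u).1 i - (f v).1 i), by ring⟩
  rw [Finset.sum_sub_distrib, h2, ← h1] at h3
  simp at h3

theorem nonempty_coloring {V : Type*} {k : ℕ} {G : SimpleGraph V} (h : Embeds G k) :
    Nonempty (G.Coloring Bool) := by
  obtain ⟨f, hf⟩ := h
  refine ⟨SimpleGraph.Coloring.mk (fun v => decide (∑ i, (f v).1 i = 1)) fun {u v} huv he => ?_⟩
  have := sum_ne_of_adj hf huv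
  simp only [decide_eq_decide] at he
  rcases (f u).2 with hu | hu <;> rcases (f v).2 with hv | hv <;> simp_all

/-- Both colors change along every edge, so their exclusive or is constant on a connected graph. -/
theorem coloring_eq_or_eq_not {V : Type*} {G : SimpleGraph V} (hG : ∀ u v, G.Reachable u v)
    (c c' : G.Coloring Bool) : (∀ v, c' v = c v) ∨ ∀ v, c' v = !(c v) := by
  have key : ∀ u v, (c' u ^^ c u) = (c' v ^^ c v) := by
    intro u v
    obtain ⟨p⟩ := hG u v
    induction p with
    | nil => rfl
    | cons h p ih =>
      rw [← ih]
      have h1 := c.valid h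
      have h2 := c'.valid h
      revert h1 h2
      generalize c _ = a
      generalize c _ = b
      generalize c' _ = a'
      generalize c' _ = b'
      revert a b a' b'
      decide
  rcases isEmpty_or_nonempty V with hV | ⟨⟨v⟩⟩
  · exact Or.inl fun v => hV.elim v
  · cases hv : (c' v ^^ c v)
    · exact Or.inl fun u => by
        have := key u v
        rw [hv] at this
        revert this
        cases c' u <;> cases c u <;> simp
    · exact Or.inr fun u => by
        have := key u v
        rw [hv] at this
        revert this
        cases c' u <;> cases c u <;> simp

theorem exists_isPlacement {V : Type*} {k : ℕ} {G : SimpleGraph V} (h : Embeds G k)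
    (c : G.Coloring Bool) : ∃ f : V → Fin (k + 1) → ℤ, IsPlacement G c f := by
  have hr := reachable_of_embeds h
  obtain ⟨f, hf⟩ := h
  have hd := dist_eq_of_isIsometricEmbedding hf
  have hc' : ∀ u v, G.Adj u v →
      decide (∑ i, (f u).1 i = 1) ≠ decide (∑ i, (f v).1 i = 1) := fun u v huv he => by
    have := sum_ne_of_adj hf huv
    simp only [decide_eq_decide] at he
    rcases (f u).2 with hu | hu <;> rcases (f v).2 with hv | hv <;> simp_all
  rcases coloring_eq_or_eq_not hr c (SimpleGraph.Coloring.mk _ fun {u v} => hc' u v) with hc | hc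
  · refine ⟨fun v => (f v).1, hr, hd, fun v => ?_⟩
    rw [← hc]
    change _ = if decide (∑ i, (f v).1 i = 1) = true then (1 : ℤ) else 0
    rcases (f v).2 with hv | hv <;> simp [hv]
  -- Here the coordinate sums give the opposite coloring. The reflection `x ↦ e₀ - x` preserves
  -- distances and exchanges the sums zero and one.
  · refine ⟨fun v i => (if i = 0 then 1 else 0) - (f v).1 i, hr, fun u v => ?_, fun v => ?_⟩
    · rw [hd]
      refine Finset.sum_congr rfl fun i _ => ?_
      rw [abs_sub_comm]
      congr 1
      ring
    · have hv' : decide (∑ i, (f v).1 i = 1) = !(c v) := hc v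
      rw [Finset.sum_sub_distrib]
      rcases (f v).2 with hv | hv <;> simp [hv] at hv' ⊢ <;> simp [hv']

/-- The differences and their absolute values both sum to one. Hence no difference is negative, and
the difference vector is a unit vector. -/
theorem IsPlacement.exists_coord {V ι : Type*} [Fintype ι] [DecidableEq ι] {G : SimpleGraph V}
    {c : V → Bool} {f : V → ι → ℤ} (h : IsPlacement G c f) {p q : V} (hpq : G.Adj p q)
    (hp : c p = true) (hq : c q = false) :
    ∃ i, ∀ j, f p j = f q j + if j = i then 1 else 0 := by
  have h1 := h.dist_eq p q
  rw [SimpleGraph.dist_eq_one_iff_adj.2 hpq] at h1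
  have h2 : ∑ i, (f p i - f q i) = 1 := by
    rw [Finset.sum_sub_distrib, h.sum_eq, h.sum_eq, hp, hq]
    simp
  have h3 : ∑ i, (|f p i - f q i| - (f p i - f q i)) = 0 := by
    rw [Finset.sum_sub_distrib, h2, ← h1]
    simp
  rw [Finset.sum_eq_zero_iff_of_nonneg fun i _ => sub_nonneg.2 (le_abs_self _)] at h3
  obtain ⟨i, hi⟩ := exists_eq_single_of_sum_eq_one (fun i => f p i - f q i)
    (fun i => by
      have := h3 i (Finset.mem_univ i)
      rw [sub_eq_zero] at this
      rw [← this]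
      exact abs_nonneg _) h2
  exact ⟨i, fun j => by have := hi j; omega⟩

/-- The vertices that are closer to `p` than to `q`. -/
def side {V : Type*} (G : SimpleGraph V) (p q : V) : Set V :=
  {v | G.dist v p < G.dist v q}

/-- The points `p` and `q` differ in coordinate `i` only, so all other terms of the two L₁ distances
agree. -/
theorem IsPlacement.dist_add {V ι : Type*} [Fintype ι] [DecidableEq ι] {G : SimpleGraph V}
    {c : V → Bool} {f : V → ι → ℤ} (h : IsPlacement G c f) {p q : V} {i : ι}
    (hi : ∀ j, f p j = f q j + if j = i then 1 else 0) (v : V) :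
    (G.dist v p : ℤ) = G.dist v q + if f p i ≤ f v i then -1 else 1 := by
  rw [h.dist_eq, h.dist_eq, ← Finset.add_sum_erase _ _ (Finset.mem_univ i),
    ← Finset.add_sum_erase _ (fun j => |f v j - f q j|) (Finset.mem_univ i)]
  have : ∑ j ∈ Finset.univ.erase i, |f v j - f p j| = ∑ j ∈ Finset.univ.erase i, |f v j - f q j| :=
    Finset.sum_congr rfl fun j hj => by
      rw [hi j, if_neg (Finset.ne_of_mem_erase hj), add_zero]
  rw [this]
  have h0 := hi i
  rw [if_pos rfl] at h0
  split_ifs with hv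
  · rw [abs_of_nonneg (by omega), abs_of_nonneg (by omega)]
    omega
  · rw [abs_of_neg (by omega), abs_of_nonpos (by omega)]
    omega

theorem IsPlacement.mem_side {V ι : Type*} [Fintype ι] [DecidableEq ι] {G : SimpleGraph V}
    {c : V → Bool} {f : V → ι → ℤ} (h : IsPlacement G c f) {p q : V} {i : ι}
    (hi : ∀ j, f p j = f q j + if j = i then 1 else 0) (v : V) :
    v ∈ side G p q ↔ f p i ≤ f v i := by
  have := h.dist_add hi v
  simp only [side, Set.mem_ofPred_eq]
  split_ifs at this <;> omega

/-- An edge moves one coordinate by one, downwards from white to black. Crossing the threshold `t`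
of coordinate `i` therefore determines the coordinate, its values and the colors. -/
theorem IsPlacement.eq_of_adj {V ι : Type*} [Fintype ι] [DecidableEq ι] {G : SimpleGraph V}
    {c : G.Coloring Bool} {f : V → ι → ℤ} (h : IsPlacement G c f) {r s : V} {i : ι} {t : ℤ}
    (hrs : G.Adj r s) (hr : t ≤ f r i) (hs : f s i < t) :
    c r = true ∧ c s = false ∧ f r i = t ∧ ∀ j, f r j = f s j + if j = i then 1 else 0 := by
  have hne := c.valid hrs
  cases hcr : c r
  · rw [hcr] at hne
    obtain ⟨j, hj⟩ := h.exists_coord hrs.symm (by simpa using hne.symm) hcr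
    have := hj i
    split_ifs at this <;> omega
  · rw [hcr] at hne
    have hcs : c s = false := by simpa using hne.symm
    obtain ⟨j, hj⟩ := h.exists_coord hrs hcr hcs
    have h1 := hj i
    by_cases hij : i = j
    · subst hij
      rw [if_pos rfl] at h1
      exact ⟨rfl, hcs, by omega, hj⟩
    · rw [if_neg hij] at h1
      omega

/-- The sides of the edges of `G` behave as in a partial cube whose cuts separate the colors: an
edge that leaves the white side of another edge leaves it from white to black, and has the same
sides. -/
structure HasColoredCuts {V : Type*} (G : SimpleGraph V) (c : G.Coloring Bool) : Prop where
  reachable : ∀ u v, G.Reachable u v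
  notMem_side : ∀ p q v, G.Adj p q → (v ∉ side G p q ↔ v ∈ side G q p)
  color : ∀ p q r s, G.Adj p q → c p = true → G.Adj r s → r ∈ side G p q → s ∉ side G p q →
    c r = true ∧ c s = false
  side_eq : ∀ p q r s, G.Adj p q → c p = true → G.Adj r s → r ∈ side G p q → s ∉ side G p q →
    side G r s = side G p q

theorem IsPlacement.hasColoredCuts {V ι : Type*} [Fintype ι] {G : SimpleGraph V}
    {c : G.Coloring Bool} {f : V → ι → ℤ} (h : IsPlacement G c f) : HasColoredCuts G c := by
  classical
  have hfalse : ∀ {p q}, G.Adj p q → c p = true → c q = false := fun hpq hp => by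
    have := c.valid hpq
    rw [hp] at this
    simpa using this.symm
  refine ⟨h.reachable, fun p q v hpq => ?_, fun p q r s hpq hp hrs hr hs => ?_,
    fun p q r s hpq hp hrs hr hs => ?_⟩
  · cases hp : c p
    · have hq : c q = true := by
        have := c.valid hpq
        rw [hp] at this
        simpa using this.symm
      obtain ⟨i, hi⟩ := h.exists_coord hpq.symm hq hp
      have := h.dist_add hi v
      simp only [side, Set.mem_ofPred_eq]
      split_ifs at this <;> omega
    · obtain ⟨i, hi⟩ := h.exists_coord hpq hp (hfalse hpq hp)
      have := h.dist_add hi v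
      simp only [side, Set.mem_ofPred_eq]
      split_ifs at this <;> omega
  · obtain ⟨i, hi⟩ := h.exists_coord hpq hp (hfalse hpq hp)
    rw [h.mem_side hi] at hr hs
    have := h.eq_of_adj hrs hr (not_le.1 hs)
    exact ⟨this.1, this.2.1⟩
  · obtain ⟨i, hi⟩ := h.exists_coord hpq hp (hfalse hpq hp)
    rw [h.mem_side hi] at hr hs
    have := h.eq_of_adj hrs hr (not_le.1 hs)
    ext v
    rw [h.mem_side this.2.2.2, h.mem_side hi, this.2.2.1]

end Diamond

namespace Diamond

/-! ### The cuts of an isometric diamond subgraph -/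

variable {V : Type*} {G : SimpleGraph V} {c : G.Coloring Bool}

theorem eq_false_of_adj {p q : V} (h : G.Adj p q) (hp : c p = true) : c q = false := by
  have := c.valid h
  rw [hp] at this
  simpa using this.symm

theorem eq_true_of_adj {p q : V} (h : G.Adj p q) (hp : c p = false) : c q = true := by
  have := c.valid h
  rw [hp] at this
  simpa using this.symm

theorem left_mem_side {p q : V} (h : G.Adj p q) : p ∈ side G p q := by
  simp [side, SimpleGraph.dist_eq_one_iff_adj.2 h]

theorem right_notMem_side (p q : V) : q ∉ side G p q := by
  simp [side]

/-- The distances of a vertex from `p` and from `q` differ by exactly one. The relation says that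
the differences at `r` and at `s` cancel, that is, have opposite signs. -/
theorem HasColoredCuts.dWRel_iff (h : HasColoredCuts G c) {p q r s : V} (hpq : G.Adj p q) :
    DWRel G p q r s ↔ Spans (side G p q) r s := by
  have hr := h.notMem_side p q r hpq
  have hs := h.notMem_side p q s hpq
  have e1 := SimpleGraph.Adj.diff_dist_adj (u := r) hpq
  have e2 := SimpleGraph.Adj.diff_dist_adj (u := s) hpq
  simp only [side, Set.mem_ofPred_eq] at hr hs
  simp only [DWRel, Spans, side, Set.mem_ofPred_eq, SimpleGraph.dist_comm (u := p),
    SimpleGraph.dist_comm (u := q)]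
  omega

theorem dWRel_swap {p q r s : V} : DWRel G q p r s ↔ DWRel G p q r s :=
  eq_comm

theorem isWhiteSide_swap {p q : V} {C : Set V} :
    IsWhiteSide G c q p C ↔ IsWhiteSide G c p q C := by
  simp only [IsWhiteSide, dWRel_swap]

theorem HasColoredCuts.isWhiteSide_side (h : HasColoredCuts G c) {p q : V} (hpq : G.Adj p q)
    (hp : c p = true) : IsWhiteSide G c p q (side G p q) :=
  ⟨fun _ _ _ => (h.dWRel_iff hpq).symm, fun r s hrs hr hs => h.color p q r s hpq hp hrs hr hs⟩

/-- Two white sides for the same class are left by the same edges in the same direction, white to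
black. So whether they agree at a vertex does not change along edges, and they agree at `p`. -/
theorem HasColoredCuts.eq_side (h : HasColoredCuts G c) {p q : V} (hpq : G.Adj p q)
    (hp : c p = true) {C : Set V} (hC : IsWhiteSide G c p q C) : C = side G p q := by
  have hside := h.isWhiteSide_side hpq hp
  have hspan : ∀ {D : Set V}, IsWhiteSide G c p q D → ∀ r s, G.Adj r s → c r = true →
      ((r ∈ D ∧ s ∉ D) ↔ DWRel G p q r s) ∧ ¬(s ∈ D ∧ r ∉ D) := by
    intro D hD r s hrs hr
    have hn : ¬(s ∈ D ∧ r ∉ D) := fun hs' => by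
      have := (hD.2 s r hrs.symm hs'.1 hs'.2).2
      simp [hr] at this
    refine ⟨?_, hn⟩
    rw [← hD.1 r s hrs]
    exact ⟨Or.inl, fun hs => hs.resolve_right hn⟩
  have hwhite : ∀ r s, G.Adj r s → c r = true →
      ((r ∈ C ↔ r ∈ side G p q) ↔ (s ∈ C ↔ s ∈ side G p q)) := by
    intro r s hrs hr
    obtain ⟨m1, n1⟩ := hspan hC r s hrs hr
    obtain ⟨m2, n2⟩ := hspan hside r s hrs hr
    rw [← m2] at m1
    clear m2 hspan hside hC
    by_cases r ∈ C <;> by_cases s ∈ C <;> by_cases r ∈ side G p q <;> by_cases s ∈ side G p q <;>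
      simp_all
  have hstep : ∀ r s, G.Adj r s → ((r ∈ C ↔ r ∈ side G p q) ↔ (s ∈ C ↔ s ∈ side G p q)) := by
    intro r s hrs
    cases hr : c r
    · exact (hwhite s r hrs.symm (eq_true_of_adj hrs hr)).symm
    · exact hwhite r s hrs hr
  have hp' : p ∈ C ↔ p ∈ side G p q := by
    have m1 := (hspan hC p q hpq hp).1
    rw [← (hspan hside p q hpq hp).1] at m1
    have := m1.2 ⟨left_mem_side hpq, right_notMem_side p q⟩
    simp [this.1, left_mem_side hpq]
  ext v
  obtain ⟨w⟩ := h.reachable v p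
  induction w with
  | nil => exact hp'
  | cons hadj w ih => exact (hstep _ _ hadj).2 (ih hpq hp hC hside hspan hwhite hstep hp')

theorem HasColoredCuts.existsUnique_isWhiteSide (h : HasColoredCuts G c) {p q : V}
    (hpq : G.Adj p q) : ∃! C, IsWhiteSide G c p q C := by
  cases hp : c p
  · simp only [isWhiteSide_swap (p := q)]
    exact ⟨_, h.isWhiteSide_side hpq.symm (eq_true_of_adj hpq hp),
      fun C hC => h.eq_side hpq.symm (eq_true_of_adj hpq hp) hC⟩
  · exact ⟨_, h.isWhiteSide_side hpq hp, fun C hC => h.eq_side hpq hp hC⟩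

theorem HasColoredCuts.mem_cuts (h : HasColoredCuts G c) {C : Set V} :
    C ∈ cuts G c ↔ ∃ p q, G.Adj p q ∧ c p = true ∧ C = side G p q := by
  constructor
  · rintro ⟨p, q, hpq, hC⟩
    cases hp : c p
    · rw [← isWhiteSide_swap] at hC
      exact ⟨q, p, hpq.symm, eq_true_of_adj hpq hp, h.eq_side hpq.symm (eq_true_of_adj hpq hp) hC⟩
    · exact ⟨p, q, hpq, hp, h.eq_side hpq hp hC⟩
  · rintro ⟨p, q, hpq, hp, rfl⟩
    exact ⟨p, q, hpq, h.isWhiteSide_side hpq hp⟩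

/-- Cuts at thresholds of the same coordinate are nested, so the choice of a coordinate is injective
on an antichain. -/
theorem IsPlacement.width_le {ι : Type*} [Fintype ι] {f : V → ι → ℤ} (h : IsPlacement G c f) :
    width (cuts G c) ≤ Fintype.card ι := by
  classical
  have hc : ∀ C : cuts G c, ∃ i t, C.1 = {v | t ≤ f v i} := by
    rintro ⟨C, hC⟩
    obtain ⟨p, q, hpq, hp, rfl⟩ := h.hasColoredCuts.mem_cuts.1 hC
    obtain ⟨i, hi⟩ := h.exists_coord hpq hp (eq_false_of_adj hpq hp)
    exact ⟨i, f p i, Set.ext fun v => h.mem_side hi v⟩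
  choose i t hit using hc
  refine iSup_le fun ⟨A, hA⟩ => ?_
  have hinj : Set.InjOn i A := by
    intro C hC D hD hCD
    rcases le_total (t C) (t D) with hle | hle
    · refine (hA.eq hD hC ?_).symm
      change D.1 ⊆ C.1
      rw [hit, hit, hCD]
      exact fun v hv => hle.trans hv
    · refine hA.eq hC hD ?_
      change C.1 ⊆ D.1
      rw [hit, hit, hCD]
      exact fun v hv => hle.trans hv
  calc A.encard = (i '' A).encard := hinj.encard_image.symm
    _ ≤ (Set.univ : Set ι).encard := Set.encard_le_encard (Set.subset_univ _)
    _ = Fintype.card ι := by simp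

theorem exists_adj_dist_eq {u v : V} {n : ℕ} (h : G.dist u v = n + 1) :
    ∃ u', G.Adj u u' ∧ G.dist u' v = n := by
  have hr : G.Reachable u v := by
    refine SimpleGraph.Reachable.of_dist_ne_zero ?_
    omega
  obtain ⟨p, hp⟩ := hr.exists_walk_length_eq_dist
  cases p with
  | nil => simp at h
  | @cons _ u' _ hadj p =>
    refine ⟨u', hadj, le_antisymm ?_ ?_⟩
    · have := SimpleGraph.dist_le p
      simp at hp
      omega
    · have h1 := SimpleGraph.Adj.diff_dist_adj (u := v) hadj
      rw [SimpleGraph.dist_comm (u := v), SimpleGraph.dist_comm (u := v)] at h1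
      omega

/-- By `side_eq`, an edge crosses no cut but its own. -/
theorem HasColoredCuts.mem_iff_of_adj (h : HasColoredCuts G c) {C : Set V} (hC : C ∈ cuts G c)
    {r s : V} (hrs : G.Adj r s) (hr : c r = true) : (r ∈ C ↔ s ∈ C) ↔ C ≠ side G r s := by
  obtain ⟨p, q, hpq, hp, rfl⟩ := h.mem_cuts.1 hC
  constructor
  · intro hiff heq
    rw [heq] at hiff
    exact right_notMem_side r s (hiff.1 (left_mem_side hrs))
  · intro hne
    refine ⟨fun hr' => by_contra fun hs => hne (h.side_eq p q r s hpq hp hrs hr' hs).symm,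
      fun hs => by_contra fun hr' => ?_⟩
    have := (h.color p q s r hpq hp hrs.symm hs hr').2
    simp [hr] at this

/-! ### Coordinates from a decomposition of the cuts into chains -/

section Chains

variable {ι J : Type*} [DecidableEq J] {C : ι → Set V}

/-- The family `C` lists the cuts without repetition. The first edge of a shortest path from `u` to
`v` crosses one cut, and `v` is beyond it; hence this cut does not separate the rest of the path
from `v` and adds one to the count. -/
theorem HasColoredCuts.exists_finset_separating (h : HasColoredCuts G c)
    (hinj : Function.Injective C) (hrange : Set.range C = cuts G c) (v : V) (n : ℕ) (u : V)
    (hn : G.dist u v = n) :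
    ∃ S : Finset ι, (∀ a, a ∈ S ↔ ¬(u ∈ C a ↔ v ∈ C a)) ∧ S.card = n := by
  classical
  induction n generalizing u with
  | zero =>
    have := ((h.reachable u v).dist_eq_zero_iff).1 hn
    subst this
    exact ⟨∅, by simp, rfl⟩
  | succ n ih =>
    obtain ⟨u', hadj, hu'⟩ := exists_adj_dist_eq hn
    obtain ⟨S, hS, hcard⟩ := ih u' hu'
    have hmem : ∀ a, C a ∈ cuts G c := fun a => hrange ▸ Set.mem_range_self a
    have hv : v ∈ side G u' u := by
      change G.dist v u' < G.dist v u
      rw [SimpleGraph.dist_comm (u := v), SimpleGraph.dist_comm (u := v)]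
      omega
    have hv' : v ∉ side G u u' := (h.notMem_side _ _ _ hadj).2 hv
    have key : ∃ a₀, (∀ a, (u ∈ C a ↔ u' ∈ C a) ↔ a ≠ a₀) ∧ (u' ∈ C a₀ ↔ v ∈ C a₀) := by
      cases hu : c u
      · have hcu' := eq_true_of_adj hadj hu
        obtain ⟨a₀, ha₀⟩ : side G u' u ∈ Set.range C :=
          hrange ▸ h.mem_cuts.2 ⟨u', u, hadj.symm, hcu', rfl⟩
        refine ⟨a₀, fun a => ?_, ?_⟩
        · rw [iff_comm (a := u ∈ C a), h.mem_iff_of_adj (hmem a) hadj.symm hcu', ← ha₀, hinj.ne_iff]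
        · rw [ha₀]
          simp [hv, left_mem_side hadj.symm]
      · obtain ⟨a₀, ha₀⟩ : side G u u' ∈ Set.range C :=
          hrange ▸ h.mem_cuts.2 ⟨u, u', hadj, hu, rfl⟩
        refine ⟨a₀, fun a => ?_, ?_⟩
        · rw [h.mem_iff_of_adj (hmem a) hadj hu, ← ha₀, hinj.ne_iff]
        · rw [ha₀]
          simp [hv', right_notMem_side]
    obtain ⟨a₀, h1, h2⟩ := key
    have ha₀ : a₀ ∉ S := by rw [hS]; simpa using h2
    refine ⟨insert a₀ S, fun a => ?_, by rw [Finset.card_insert_of_notMem ha₀, hcard]⟩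
    have := h1 a
    rw [Finset.mem_insert, hS]
    by_cases haa : a = a₀
    · subst haa
      tauto
    · tauto

open Classical in
/-- The coordinates determined by an assignment `κ` of the cuts `C a` to chains: the coordinate `j`
of `v` is the signed number of cuts of the chain `j` that separate `v` from `v₀`. -/
noncomputable def chainCoord (C : ι → Set V) (κ : ι → J) (v₀ v : V) (j : J) : ℤ :=
  ∑ᶠ a, if κ a = j then (if v ∈ C a then 1 else 0) - (if v₀ ∈ C a then 1 else 0) else 0

open Classical in
theorem HasColoredCuts.chainCoord_sub (h : HasColoredCuts G c)
    (hinj : Function.Injective C) (hrange : Set.range C = cuts G c) (κ : ι → J) (v₀ u v : V)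
    {S : Finset ι} (hS : ∀ a, a ∈ S ↔ ¬(u ∈ C a ↔ v ∈ C a)) (j : J) :
    chainCoord C κ v₀ u j - chainCoord C κ v₀ v j =
      ∑ a ∈ S with κ a = j, ((if u ∈ C a then 1 else 0) - (if v ∈ C a then 1 else 0)) := by
  -- There may be infinitely many cuts, but only finitely many separate `w` from `v₀`, so the
  -- `finsum` does not take its default value.
  have hfin : ∀ w, (Function.support fun a => if κ a = j then
      (if w ∈ C a then (1 : ℤ) else 0) - (if v₀ ∈ C a then 1 else 0) else 0).Finite := by
    intro w
    obtain ⟨T, hT, -⟩ := h.exists_finset_separating hinj hrange v₀ _ w rfl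
    refine T.finite_toSet.subset fun a ha => ?_
    rw [Finset.mem_coe, hT]
    intro hiff
    simp [hiff] at ha
  rw [chainCoord, chainCoord, ← finsum_sub_distrib (hfin u) (hfin v), Finset.sum_filter]
  rw [finsum_eq_sum_of_support_subset (s := S)]
  · refine Finset.sum_congr rfl fun a _ => ?_
    split_ifs <;> simp
  · intro a ha
    rw [Finset.mem_coe, hS]
    intro hiff
    simp [hiff] at ha

theorem HasColoredCuts.isPlacement_chainCoord [Fintype J] (h : HasColoredCuts G c)
    (hinj : Function.Injective C) (hrange : Set.range C = cuts G c) (κ : ι → J)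
    (hκ : ∀ a b, κ a = κ b → C a ⊆ C b ∨ C b ⊆ C a) {v₀ : V} (hv₀ : c v₀ = false) :
    IsPlacement G c (chainCoord C κ v₀) := by
  classical
  have hmem : ∀ a, C a ∈ cuts G c := fun a => hrange ▸ Set.mem_range_self a
  refine ⟨h.reachable, fun u v => ?_, fun v => ?_⟩
  · obtain ⟨S, hS, hcard⟩ := h.exists_finset_separating hinj hrange v _ u rfl
    rw [← hcard, Finset.card_eq_sum_card_fiberwise (f := κ) (t := Finset.univ) (by simp)]
    push_cast
    refine Finset.sum_congr rfl fun j _ => ?_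
    rw [h.chainCoord_sub hinj hrange κ v₀ u v hS]
    -- Cuts crossed in opposite directions between `u` and `v` are not nested, so within a chain all
    -- terms have the same sign and nothing cancels.
    have hsign : (∀ a ∈ S.filter (κ · = j), u ∈ C a) ∨ ∀ a ∈ S.filter (κ · = j), v ∈ C a := by
      by_contra! hcon
      obtain ⟨⟨a, ha, hua⟩, b, hb, hvb⟩ := hcon
      rw [Finset.mem_filter, hS] at ha hb
      rcases hκ a b (ha.2.trans hb.2.symm) with hab | hab
      · have := @hab v
        tauto
      · have := @hab u
        tauto
    rcases hsign with hs | hs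
    · have : ∀ a ∈ S.filter (κ · = j),
          ((if u ∈ C a then (1 : ℤ) else 0) - (if v ∈ C a then 1 else 0)) = 1 := by
        intro a ha
        have hu := hs a ha
        rw [Finset.mem_filter, hS] at ha
        have : v ∉ C a := by tauto
        simp [hu, this]
      rw [Finset.sum_congr rfl this]
      simp
    · have : ∀ a ∈ S.filter (κ · = j),
          ((if u ∈ C a then (1 : ℤ) else 0) - (if v ∈ C a then 1 else 0)) = -1 := by
        intro a ha
        have hv := hs a ha
        rw [Finset.mem_filter, hS] at ha
        have : u ∉ C a := by tauto
        simp [hv, this]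
      rw [Finset.sum_congr rfl this]
      simp
  -- An edge crosses its own cut only, from white to black. The sums follow along a walk from the
  -- base vertex, which is black and has sum zero.
  · have hedge : ∀ r s, G.Adj r s → c r = true →
        ∑ j, chainCoord C κ v₀ r j - ∑ j, chainCoord C κ v₀ s j = 1 := by
      intro r s hrs hr
      obtain ⟨a₀, ha₀⟩ : side G r s ∈ Set.range C :=
        hrange ▸ h.mem_cuts.2 ⟨r, s, hrs, hr, rfl⟩
      have hS : ∀ a, a ∈ ({a₀} : Finset ι) ↔ ¬(r ∈ C a ↔ s ∈ C a) := by
        intro a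
        rw [h.mem_iff_of_adj (hmem a) hrs hr, ← ha₀, hinj.ne_iff]
        simp
      rw [← Finset.sum_sub_distrib]
      simp only [h.chainCoord_sub hinj hrange κ v₀ r s hS]
      rw [Finset.sum_fiberwise, Finset.sum_singleton, ha₀]
      simp [left_mem_side hrs, right_notMem_side]
    obtain ⟨w⟩ := h.reachable v v₀
    induction w with
    | nil => simp [chainCoord, hv₀]
    | @cons u u' v₀ hadj w ih =>
      have ih := ih hv₀ hedge
      cases hu : c u
      · have hu' := eq_true_of_adj hadj hu
        have := hedge u' u hadj.symm hu'
        simp [hu'] at ih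
        simp
        omega
      · have hu' := eq_false_of_adj hadj hu
        have := hedge u u' hadj hu
        simp [hu'] at ih
        simp
        omega

end Chains
end Diamond

namespace Diamond

/-! ### Minimum chain decompositions by an auction -/

section Auction

variable {α : Type*}

/-- The state of the auction: a matching, and a price for each element. -/
structure AuctionState (α : Type*) where
  matched : α → α → Prop
  price : α → ℤ

/-- The unmatched element `l` may bid for `r`, which is one of the cheapest elements above it. -/
def AuctionState.Enabled (lt : α → α → Prop) (T : ℤ) (s : AuctionState α) (l r : α) : Prop :=
  lt l r ∧ (∀ r', ¬ s.matched l r') ∧ s.price r < T ∧ ∀ r', lt l r' → s.price r ≤ s.price r'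

/-- The state after the bid of `l` for `r`. -/
def AuctionState.bid [DecidableEq α] (s : AuctionState α) (l r : α) : AuctionState α where
  matched x y := if y = r then x = l else s.matched x y
  price y := s.price y + if y = r then 1 else 0

/-- One step of the auction. -/
def AuctionState.IsStep [DecidableEq α] (lt : α → α → Prop) (T : ℤ) (s s' : AuctionState α) :
    Prop :=
  (∃ l r, s.Enabled lt T l r ∧ s' = s.bid l r) ∨ ((∀ l r, ¬ s.Enabled lt T l r) ∧ s' = s)

/-- The invariants of the auction. -/
structure AuctionState.Invariant (lt : α → α → Prop) (T : ℤ) (s : AuctionState α) : Prop where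
  lt_of_matched : ∀ l r, s.matched l r → lt l r
  right_unique : ∀ l r r', s.matched l r → s.matched l r' → r = r'
  left_unique : ∀ l l' r, s.matched l r → s.matched l' r → l = l'
  nonneg : ∀ r, 0 ≤ s.price r
  le : ∀ r, s.price r ≤ T
  exists_matched : ∀ r, 0 < s.price r → ∃ l, s.matched l r
  slack : ∀ l r r', s.matched l r → lt l r' → s.price r ≤ s.price r' + 1

/-- The only price that rises is that of `r`, by one, and `r` was cheapest for `l`; this keeps
`slack`. An element that is outbid becomes unmatched, but `r` stays matched. -/
theorem AuctionState.Invariant.bid [DecidableEq α] {lt : α → α → Prop} {T : ℤ}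
    {s : AuctionState α} (h : s.Invariant lt T) {l r : α} (he : s.Enabled lt T l r) :
    (s.bid l r).Invariant lt T := by
  obtain ⟨hlt, hfree, hT, hmin⟩ := he
  have hp : ∀ y, s.price y ≤ (s.bid l r).price y := fun y => by
    simp only [AuctionState.bid]
    split_ifs <;> omega
  refine ⟨fun x y hxy => ?_, fun x y y' hy hy' => ?_, fun x x' y hx hx' => ?_, fun y => ?_,
    fun y => ?_, fun y hy => ?_, fun x y y' hxy hxy' => ?_⟩
  · simp only [AuctionState.bid] at hxy
    split_ifs at hxy with hyr
    · rw [hxy, hyr]; exact hlt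
    · exact h.lt_of_matched _ _ hxy
  · simp only [AuctionState.bid] at hy hy'
    split_ifs at hy hy' with h1 h2 h2
    · rw [h1, h2]
    · exact absurd (hy ▸ hy') (hfree y')
    · exact absurd (hy' ▸ hy) (hfree y)
    · exact h.right_unique _ _ _ hy hy'
  · simp only [AuctionState.bid] at hx hx'
    split_ifs at hx hx'
    · rw [hx, hx']
    · exact h.left_unique _ _ _ hx hx'
  · exact (h.nonneg y).trans (hp y)
  · simp only [AuctionState.bid]
    have := h.le y
    split_ifs with hyr
    · subst hyr; omega
    · omega
  · simp only [AuctionState.bid] at hy ⊢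
    split_ifs at hy ⊢ with hyr
    · exact ⟨l, rfl⟩
    · exact h.exists_matched y (by omega)
  · have hy' := hp y'
    simp only [AuctionState.bid] at hxy
    have e : (s.bid l r).price y = s.price y + if y = r then 1 else 0 := rfl
    split_ifs at hxy with hyr
    · subst hxy hyr
      have := hmin y' hxy'
      rw [e, if_pos rfl]
      omega
    · have := h.slack x y y' hxy hxy'
      rw [e, if_neg hyr]
      omega

variable [Fintype α]

/-- Each bid raises the total price by one, and no price exceeds `T`. Once no bid is enabled, the
state no longer changes. -/
theorem AuctionState.stable_of_isStep [DecidableEq α] {lt : α → α → Prop} {T : ℤ}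
    {s : ℕ → AuctionState α}
    (h0 : (s 0).Invariant lt T) (hs : ∀ k, (s k).IsStep lt T (s (k + 1))) {K : ℕ}
    (hK : Fintype.card α * T < K) :
    (s K).Invariant lt T ∧ ∀ l r, ¬ (s K).Enabled lt T l r := by
  have key : ∀ k, (s k).Invariant lt T ∧
      ((∀ l r, ¬ (s k).Enabled lt T l r) ∨ (k : ℤ) ≤ ∑ y, (s k).price y) := by
    intro k
    induction k with
    | zero => exact ⟨h0, Or.inr (by simpa using Finset.sum_nonneg fun i _ => h0.nonneg i)⟩
    | succ k ih =>
      rcases hs k with ⟨l, r, he, heq⟩ | ⟨hst, heq⟩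
      · rw [heq]
        refine ⟨ih.1.bid he, Or.inr ?_⟩
        have := ih.2.resolve_left fun hst => hst l r he
        simp only [AuctionState.bid, Finset.sum_add_distrib]
        simpa using this
      · rw [heq]
        exact ⟨ih.1, Or.inl hst⟩
  refine ⟨(key K).1, (key K).2.resolve_right fun hle => ?_⟩
  have : ∑ y, (s K).price y ≤ ∑ _y : α, T := Finset.sum_le_sum fun y _ => (key K).1.le y
  simp at this
  omega

open Classical in
/-- A stable state has an antichain that has at least as many elements as there are chains. -/
theorem AuctionState.Invariant.exists_antichain {lt : α → α → Prop} {s : AuctionState α}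
    {T : ℤ} (hT : T = Fintype.card α + 2) (h : s.Invariant lt T)
    (hst : ∀ l r, ¬ s.Enabled lt T l r) :
    ∃ A : Finset α, (∀ u ∈ A, ∀ v ∈ A, ¬ lt u v) ∧
      (Finset.univ.filter fun r => ∀ l, ¬ s.matched l r).card ≤ A.card := by
  -- The interval has one more element than there can be prices.
  obtain ⟨g, hg, hgap⟩ : ∃ g ∈ Finset.Icc (1 : ℤ) (Fintype.card α + 1),
      g ∉ Finset.univ.image s.price := by
    by_contra! hcon
    have h1 := Finset.card_le_card hcon
    have h2 := Finset.card_image_le (s := Finset.univ) (f := s.price)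
    simp at h1 h2
    omega
  rw [Finset.mem_Icc] at hg
  have hgap : ∀ r, s.price r ≠ g := by simpa using hgap
  -- As in König's theorem: with `B` as lower ends and `H` as upper ends, all comparable pairs are
  -- covered, and the cover is no larger than the matching.
  let B := Finset.univ.filter fun v => ∃ r, s.matched v r ∧ s.price r < g
  let H := Finset.univ.filter fun v => g < s.price v
  refine ⟨(B ∪ H)ᶜ, fun u hu v hv huv => ?_, ?_⟩
  · simp only [B, H, Finset.mem_compl, Finset.mem_union, Finset.mem_filter, Finset.mem_univ,
      true_and, not_or, not_exists, not_and, not_lt] at hu hv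
    have hv' : s.price v < g := lt_of_le_of_ne hv.2 (hgap v)
    by_cases hfree : ∃ r, s.matched u r
    -- As `u` is not in `B` and `g` is not a price, `r` costs more than `g`; but by `slack` it costs
    -- at most one more than `v`, hence at most `g`.
    · obtain ⟨r, hr⟩ := hfree
      have h1 := h.slack u r v hr huv
      have h2 := hu.1 r hr
      have h3 := hgap r
      omega
    · push Not at hfree
      -- An unmatched `u` could still bid for a cheapest element above it, whose price is less than
      -- `g` and so less than `T`.
      obtain ⟨r, hr, hmin⟩ := Finset.exists_min_image (Finset.univ.filter (lt u)) s.price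
        ⟨v, by simpa using huv⟩
      simp only [Finset.mem_filter, Finset.mem_univ, true_and] at hr hmin
      exact hst u r ⟨hr, hfree, by have := hmin v huv; omega, hmin⟩
  -- Elements of `B` are counted by their partners, which cost less than `g`; elements of `H` have
  -- positive prices and are matched from below themselves. Both together are at most the elements
  -- that are not bottoms of chains.
  · have hB : B.card ≤ (Finset.univ.filter fun r => (∃ l, s.matched l r) ∧ ¬ g < s.price r).card := by
      refine Finset.card_le_card_of_forall_subsingleton (fun v r => s.matched v r) ?_ ?_
      · intro v hv
        simp only [B, Finset.mem_filter, Finset.mem_univ, true_and] at hv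
        obtain ⟨r, hr, hlt⟩ := hv
        exact ⟨r, by simpa using ⟨⟨v, hr⟩, hlt.le⟩, hr⟩
      · intro r _ v hv v' hv'
        exact h.left_unique v v' r hv.2 hv'.2
    have hH : H.card ≤ (Finset.univ.filter fun r => (∃ l, s.matched l r) ∧ g < s.price r).card := by
      refine Finset.card_le_card fun r hr => ?_
      simp only [H, Finset.mem_filter, Finset.mem_univ, true_and] at hr ⊢
      exact ⟨h.exists_matched r (by omega), hr⟩
    have hU := Finset.card_union_le B H
    have e1 : (Finset.univ.filter fun r => ∃ l, s.matched l r).card =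
        (Finset.univ.filter fun r => (∃ l, s.matched l r) ∧ g < s.price r).card +
        (Finset.univ.filter fun r => (∃ l, s.matched l r) ∧ ¬ g < s.price r).card := by
      rw [← Finset.card_filter_add_card_filter_not (fun r => g < s.price r), Finset.filter_filter,
        Finset.filter_filter]
    have e2 := Finset.card_filter_add_card_filter_not (s := Finset.univ)
      (fun r => ∃ l, s.matched l r)
    simp only [not_exists, Finset.card_univ] at e2
    rw [Finset.card_compl]
    have := (B ∪ H).card_le_univ
    omega

/-- Elements with the same label are comparable if matched elements have equal labels, and
different bottom elements of chains have different labels. -/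
theorem AuctionState.Invariant.comparable {lt : α → α → Prop} {s : AuctionState α} {T : ℤ}
    (h : s.Invariant lt T) (hirr : ∀ u, ¬ lt u u) (htr : ∀ u v w, lt u v → lt v w → lt u w)
    {J : Type*} {κ : α → J} (hκ : ∀ l r, s.matched l r → κ l = κ r)
    (hroot : ∀ r r', (∀ l, ¬ s.matched l r) → (∀ l, ¬ s.matched l r') → κ r = κ r' → r = r')
    {u v : α} (huv : κ u = κ v) : u = v ∨ lt u v ∨ lt v u := by
  have hwf : WellFounded lt := by
    have : IsTrans α lt := ⟨htr⟩
    have : Std.Irrefl lt := ⟨hirr⟩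
    exact Finite.wellFounded_of_trans_of_irrefl lt
  have hex : ∀ v, ∃ r, (∀ l, ¬ s.matched l r) ∧ κ r = κ v ∧
      Relation.ReflTransGen s.matched r v := by
    intro v
    induction v using hwf.induction with
    | _ v ih =>
      by_cases hv : ∃ l, s.matched l v
      · obtain ⟨l, hl⟩ := hv
        obtain ⟨r, hr, hrl, hrt⟩ := ih l (h.lt_of_matched l v hl)
        exact ⟨r, hr, hrl.trans (hκ l v hl), hrt.tail hl⟩
      · push Not at hv
        exact ⟨v, hv, rfl, .refl⟩
  have hlt : ∀ {u v}, Relation.ReflTransGen s.matched u v → u = v ∨ lt u v := by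
    intro u v huv
    induction huv with
    | refl => exact Or.inl rfl
    | tail _ hm ih =>
      have := h.lt_of_matched _ _ hm
      rcases ih with rfl | ih
      · exact Or.inr this
      · exact Or.inr (htr _ _ _ ih this)
  obtain ⟨r, hr, hru, hu⟩ := hex u
  obtain ⟨r', hr', hrv, hv⟩ := hex v
  obtain rfl := hroot r r' hr hr' (by rw [hru, hrv, huv])
  -- Equal labels mean a common bottom element, and the matching leads upwards from it along a
  -- single path.
  rcases Relation.ReflTransGen.total_of_right_unique
    (fun a b b' hb hb' => h.right_unique a b b' hb hb') hu hv with huv | hvu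
  · exact (hlt huv).elim Or.inl fun h => Or.inr (Or.inl h)
  · exact (hlt hvu).elim (fun h => Or.inl h.symm) fun h => Or.inr (Or.inr h)

/-- The initial state of the auction. -/
def AuctionState.initial : AuctionState α := ⟨fun _ _ => False, fun _ => 0⟩

omit [Fintype α] in
theorem AuctionState.initial_invariant (lt : α → α → Prop) {T : ℤ} (hT : 0 ≤ T) :
    (AuctionState.initial : AuctionState α).Invariant lt T := by
  constructor <;> simp [AuctionState.initial, hT]

/-- **Dilworth's theorem** for finite partial orders. -/
theorem exists_chains_of_finite {lt : α → α → Prop} (hirr : ∀ u, ¬ lt u u)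
    (htr : ∀ u v w, lt u v → lt v w → lt u w) :
    ∃ A : Finset α, (∀ u ∈ A, ∀ v ∈ A, ¬ lt u v) ∧ ∃ κ : α → Fin A.card,
      ∀ u v, κ u = κ v → u = v ∨ lt u v ∨ lt v u := by
  classical
  let T : ℤ := Fintype.card α + 2
  have hnext : ∀ s : AuctionState α, ∃ s', s.IsStep lt T s' := fun s => by
    by_cases h : ∃ l r, s.Enabled lt T l r
    · obtain ⟨l, r, h⟩ := h
      exact ⟨_, Or.inl ⟨l, r, h, rfl⟩⟩
    · push Not at h
      exact ⟨_, Or.inr ⟨h, rfl⟩⟩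
  choose F hF using hnext
  obtain ⟨hinv, hst⟩ := AuctionState.stable_of_isStep
    (s := fun k => F^[k] AuctionState.initial) (K := Fintype.card α * (Fintype.card α + 2) + 1)
    (AuctionState.initial_invariant lt (T := T) (by positivity))
    (fun k => by simpa only [Function.iterate_succ_apply'] using hF _)
    (by push_cast [T]; omega)
  set s := F^[Fintype.card α * (Fintype.card α + 2) + 1] AuctionState.initial
  obtain ⟨A, hA, hcard⟩ := hinv.exists_antichain rfl hst
  refine ⟨A, hA, ?_⟩
  have hwf : WellFounded lt := by
    have : IsTrans α lt := ⟨htr⟩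
    have : Std.Irrefl lt := ⟨hirr⟩
    exact Finite.wellFounded_of_trans_of_irrefl lt
  -- The label is the bottom of the chain, found by following the matching downwards.
  let κ : α → Finset.univ.filter fun r => ∀ l, ¬ s.matched l r :=
    hwf.fix fun v rec => if h : ∃ l, s.matched l v then
      rec h.choose (hinv.lt_of_matched _ _ h.choose_spec) else ⟨v, by simpa using h⟩
  have hκ : ∀ v, κ v = if h : ∃ l, s.matched l v then κ h.choose else ⟨v, by simpa using h⟩ :=
    fun v => hwf.fix_eq _ v
  refine ⟨fun v => Fin.castLE hcard ((Finset.equivFin _) (κ v)), fun u v huv => ?_⟩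
  refine hinv.comparable hirr htr (κ := κ) (fun l r hlr => ?_) (fun r r' hr hr' he => ?_)
    (by simpa using huv)
  · have hex : ∃ l, s.matched l r := ⟨l, hlr⟩
    rw [hκ r, dif_pos hex, hinv.left_unique _ _ _ hlr hex.choose_spec]
  · rw [hκ r, hκ r', dif_neg (by simpa using hr), dif_neg (by simpa using hr')] at he
    simpa using he

end Auction

/-- **Dilworth's theorem** for partial orders of finite width. -/
theorem exists_chains_of_width_le {α : Type*} [PartialOrder α] {w : ℕ} (hw0 : 0 < w)
    (hw : width α ≤ w) : ∃ κ : α → Fin w, ∀ a b, κ a = κ b → a ≤ b ∨ b ≤ a := by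
  classical
  have : NeZero w := ⟨hw0.ne'⟩
  have hfin : ∀ S : Finset α, ∃ κ : α → Fin w, ∀ a ∈ S, ∀ b ∈ S, κ a = κ b → a ≤ b ∨ b ≤ a := by
    intro S
    obtain ⟨A, hA, κ, hκ⟩ := exists_chains_of_finite (α := S) (lt := (· < ·)) (fun u => lt_irrefl u)
      (fun u v w => lt_trans)
    have hcard : A.card ≤ w := by
      have hanti : IsAntichain (· ≤ ·) ((A.map (Function.Embedding.subtype _) : Finset α) : Set α) := by
        intro a ha b hb hab hle
        simp only [Finset.coe_map, Set.mem_image, Finset.mem_coe] at ha hb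
        obtain ⟨a, ha, rfl⟩ := ha
        obtain ⟨b, hb, rfl⟩ := hb
        exact hA a ha b hb (lt_of_le_of_ne hle fun h => hab (by rw [h]))
      have h1 := (le_iSup (fun A : {A : Set α // IsAntichain (· ≤ ·) A} => A.1.encard)
        ⟨_, hanti⟩).trans hw
      simp only [Set.encard_coe_eq_coe_finsetCard, Finset.card_map] at h1
      exact_mod_cast h1
    refine ⟨fun a => if h : a ∈ S then Fin.castLE hcard (κ ⟨a, h⟩) else 0,
      fun a ha b hb hab => ?_⟩
    simp only [ha, hb, dif_pos, Fin.castLE_inj] at hab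
    rcases hκ _ _ hab with h | h | h
    · exact Or.inl (congrArg Subtype.val h).le
    · exact Or.inl (le_of_lt h)
    · exact Or.inr (le_of_lt h)
  choose g hg using hfin
  -- Compactness: on each pair, `χ` agrees with the labelling chosen for some finite set that
  -- contains the pair.
  obtain ⟨χ, hχ⟩ := Finset.rado_selection g
  refine ⟨χ, fun a b hab => ?_⟩
  obtain ⟨t, hst, ht⟩ := hχ {a, b}
  rw [ht a (by simp), ht b (by simp)] at hab
  exact hg t a (hst (by simp)) b (hst (by simp)) hab

/-! ### The diamond dimension -/

theorem dimension_spec {V : Type*} {G : SimpleGraph V} (h : IsIsometricDiamondSubgraph G) :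
    Embeds G (dimension G) :=
  Nat.sInf_mem (s := {k | Embeds G k}) h

theorem dimension_le {V : Type*} {G : SimpleGraph V} {k : ℕ} (h : Embeds G k) : dimension G ≤ k :=
  Nat.sInf_le (s := {k | Embeds G k}) h

theorem exists_adj_of_reachable {V : Type*} [Nontrivial V] {G : SimpleGraph V}
    (h : ∀ u v, G.Reachable u v) (u : V) : ∃ v, G.Adj u v := by
  obtain ⟨w, hw⟩ := exists_ne u
  obtain ⟨p⟩ := h u w
  cases p with
  | nil => exact absurd rfl hw
  | cons hadj _ => exact ⟨_, hadj⟩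

theorem dimension_add_one_eq_width {V : Type*} [Nontrivial V] {G : SimpleGraph V}
    (h : IsIsometricDiamondSubgraph G) (c : G.Coloring Bool) :
    (dimension G : ℕ∞) + 1 = width (cuts G c) := by
  obtain ⟨f, hf⟩ := exists_isPlacement (dimension_spec h) c
  have hcol := hf.hasColoredCuts
  have hle : width (cuts G c) ≤ (dimension G : ℕ∞) + 1 := by simpa using hf.width_le
  refine le_antisymm ?_ hle
  obtain ⟨w, hw⟩ := ENat.ne_top_iff_exists.1 (ne_top_of_le_ne_top (by simp) hle)
  obtain ⟨p, q, hpq, hp⟩ : ∃ p q, G.Adj p q ∧ c p = true := by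
    obtain ⟨u⟩ := (inferInstance : Nonempty V)
    obtain ⟨v, huv⟩ := exists_adj_of_reachable hcol.reachable u
    cases hu : c u
    · exact ⟨v, u, huv.symm, eq_true_of_adj huv hu⟩
    · exact ⟨u, v, huv, hu⟩
  -- There is an edge, hence a cut; so the width is positive and can be written as `k + 1`.
  have hw0 : 0 < w := by
    let C : cuts G c := ⟨side G p q, hcol.mem_cuts.2 ⟨p, q, hpq, hp, rfl⟩⟩
    have := le_iSup (fun A : {A : Set (cuts G c) // IsAntichain (· ≤ ·) A} => A.1.encard)
      ⟨{C}, Set.subsingleton_singleton.isAntichain _⟩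
    change _ ≤ width (cuts G c) at this
    rw [← hw] at this
    simp only [Set.encard_singleton] at this
    exact_mod_cast this
  obtain ⟨k, rfl⟩ := Nat.exists_eq_add_of_le' hw0
  obtain ⟨κ, hκ⟩ := exists_chains_of_width_le hw0 hw.symm.le
  have hemb : Embeds G k := (hcol.isPlacement_chainCoord (C := fun C : cuts G c => C.1)
    Subtype.val_injective Subtype.range_coe κ (fun a b hab => hκ a b hab)
    (eq_false_of_adj hpq hp)).embeds
  rw [← hw]
  exact_mod_cast Nat.succ_le_succ (dimension_le hemb)

theorem cuts_and_dimension {V : Type*} [Nontrivial V] {G : SimpleGraph V}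
    (h : IsIsometricDiamondSubgraph G) :
    Nonempty (G.Coloring Bool) ∧ ∀ c : G.Coloring Bool,
      (∀ p q, G.Adj p q → ∃! C, IsWhiteSide G c p q C) ∧
      (dimension G : ℕ∞) + 1 = width (cuts G c) := by
  refine ⟨nonempty_coloring (dimension_spec h), fun c => ⟨fun p q hpq => ?_,
    dimension_add_one_eq_width h c⟩⟩
  obtain ⟨f, hf⟩ := exists_isPlacement (dimension_spec h) c
  exact hf.hasColoredCuts.existsUnique_isWhiteSide hpq

/-- Coordinates that are constantly zero are appended. -/
theorem Embeds.mono {V : Type*} {G : SimpleGraph V} {k l : ℕ} (h : Embeds G k) (hkl : k ≤ l) :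
    Embeds G l := by
  obtain ⟨c⟩ := nonempty_coloring h
  obtain ⟨f, hf⟩ := exists_isPlacement h c
  obtain ⟨d, rfl⟩ := Nat.exists_eq_add_of_le hkl
  let e : Fin (k + 1) ⊕ Fin d ≃ Fin (k + d + 1) :=
    finSumFinEquiv.trans (finCongr (by omega))
  refine IsPlacement.embeds (c := c) (f := fun v i => Sum.elim (f v) (fun _ => 0) (e.symm i))
    ⟨hf.reachable, fun u v => ?_, fun v => ?_⟩
  · rw [← e.sum_comp]
    simp [hf.dist_eq u v]
  · rw [← e.sum_comp]
    simp [hf.sum_eq v]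

theorem embeds_iff_dimension_le {V : Type*} {G : SimpleGraph V}
    (h : IsIsometricDiamondSubgraph G) (k : ℕ) : Embeds G k ↔ dimension G ≤ k :=
  ⟨dimension_le, (dimension_spec h).mono⟩

/-! ### A language of matrix programs

Matrix programs work on `N × N` matrices of integers.  Their running time on the random access
machine is polynomial by construction. -/

/-- The expressions of matrix programs, with variables for indices. -/
inductive MExpr : Type
  | const (z : ℤ)
  | idx (x : ℕ)
  | read (a x y : ℕ)
  | add (e f : MExpr)
  | sub (e f : MExpr)
  | ite (x y e f : MExpr)
  | sum (x : ℕ) (e : MExpr)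

/-- The value of an expression, for the matrices `σ` and the values `ρ` of the variables. -/
def MExpr.eval {N : ℕ} (σ : ℕ → Fin N → Fin N → ℤ) : MExpr → (ℕ → Fin N) → ℤ
  | .const z, _ => z
  | .idx x, ρ => ((ρ x : ℕ) : ℤ)
  | .read a x y, ρ => σ a (ρ x) (ρ y)
  | .add e f, ρ => e.eval σ ρ + f.eval σ ρ
  | .sub e f, ρ => e.eval σ ρ - f.eval σ ρ
  | .ite x y e f, ρ => if x.eval σ ρ < y.eval σ ρ then e.eval σ ρ else f.eval σ ρ
  | .sum x e, ρ => ∑ i, e.eval σ (Function.update ρ x i)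

/-- Matrix programs: `fill a e` replaces the matrix `a` by the matrix with the entries `e`, in which
the variables `0` and `1` are the indices and the other variables are zero, and `rep P` executes `P`
as often as there are rows. -/
inductive MProgram : Type
  | fill (a : ℕ) (e : MExpr)
  | seq (P Q : MProgram)
  | rep (P : MProgram)

/-- The environment in which the entries of a matrix are computed. -/
def entryEnv {N : ℕ} [NeZero N] (i j : Fin N) : ℕ → Fin N :=
  Function.update (Function.update (fun _ => 0) 0 i) 1 j

/-- The effect of a matrix program. -/
def MProgram.exec {N : ℕ} [NeZero N] : MProgram → (ℕ → Fin N → Fin N → ℤ) →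
    (ℕ → Fin N → Fin N → ℤ)
  | .fill a e, σ => Function.update σ a fun i j => e.eval σ (entryEnv i j)
  | .seq P Q, σ => Q.exec (P.exec σ)
  | .rep P, σ => P.exec^[N] σ

/-! ### Compilation of matrix programs -/

/-- Started in `σ`, the program `P` halts after at most `B` steps, in a memory that satisfies
`post`. -/
def Reaches (P : Program) (σ : Memory) (B : ℕ) (post : Memory → Prop) : Prop :=
  ∃ τ t, Runs P σ τ t ∧ t ≤ B ∧ post τ

theorem Reaches.mono {P : Program} {σ : Memory} {B B' : ℕ} {post post' : Memory → Prop}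
    (h : Reaches P σ B post) (hB : B ≤ B') (hpost : ∀ τ, post τ → post' τ) :
    Reaches P σ B' post' := by
  obtain ⟨τ, t, hr, ht, hp⟩ := h
  exact ⟨τ, t, hr, ht.trans hB, hpost τ hp⟩

theorem Reaches.seq {P Q : Program} {σ : Memory} {B C : ℕ} {post : Memory → Prop}
    (h : Reaches P σ B fun τ => Reaches Q τ C post) : Reaches (.seq P Q) σ (B + C) post := by
  obtain ⟨τ, t, hr, ht, υ, u, hr', hu, hp⟩ := h
  exact ⟨υ, t + u, .seq hr hr', add_le_add ht hu, hp⟩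

theorem Reaches.write {σ : Memory} {a : ℕ} {i j e : Expr} {post : Memory → Prop}
    (h : post (σ.set a (i.eval σ) (j.eval σ) (e.eval σ))) :
    Reaches (.write a i j e) σ (i.cost + j.cost + e.cost + 1) post :=
  ⟨_, _, .write σ a i j e, le_rfl, h⟩

theorem Reaches.ite {σ : Memory} {x y : Expr} {P Q : Program} {B C : ℕ} {post : Memory → Prop}
    (hP : x.eval σ < y.eval σ → Reaches P σ B post)
    (hQ : ¬ x.eval σ < y.eval σ → Reaches Q σ C post) :
    Reaches (.ite x y P Q) σ (x.cost + y.cost + 1 + (B + C)) post := by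
  by_cases h : x.eval σ < y.eval σ
  · obtain ⟨τ, t, hr, ht, hp⟩ := hP h
    exact ⟨τ, _, .ite_true h hr, by omega, hp⟩
  · obtain ⟨τ, t, hr, ht, hp⟩ := hQ h
    exact ⟨τ, _, .ite_false h hr, by omega, hp⟩

/-- The entry `(i, 0)` of the array `a`. -/
def cell (a : ℕ) (i : ℤ) : Expr := .read a (.const i) (.const 0)

/-- The assignment of `e` to the entry `(i, 0)` of the array `a`. -/
def put (a : ℕ) (i : ℤ) (e : Expr) : Program := .write a (.const i) (.const 0) e

/-- Execute `P` for all values less than the size of the entry `(i, 0)` of the array `a`. -/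
def forLoop (a : ℕ) (i : ℤ) (P : Program) : Program :=
  .seq (put a i (.const 0))
    (.loop (cell a i) (cell 4 (-1)) (.seq P (put a i (.add (cell a i) (.const 1)))))

theorem eval_cell (σ : Memory) (a : ℕ) (i : ℤ) : (cell a i).eval σ = σ a i 0 := rfl

theorem Reaches.put {σ : Memory} {a : ℕ} {i : ℤ} {e : Expr} {post : Memory → Prop}
    (h : post (σ.set a i 0 (e.eval σ))) : Reaches (put a i e) σ (e.cost + 3) post :=
  (Reaches.write (i := .const i) (j := .const 0) h).mono (by simp only [Expr.cost]; omega)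
    fun _ h => h

/-- The invariant `I k` describes the memory before round `k`. Setting the counter takes 4 steps, a
test 7 and an increment 8; so there are 11 steps for the start and the last test, and `B + 15` for
each round. -/
theorem Reaches.forLoop {a : ℕ} {i : ℤ} {P : Program} {N B : ℕ} (I : ℕ → Memory → Prop)
    (hI : ∀ k τ, I k τ → τ a i 0 = k ∧ τ 4 (-1) 0 = N)
    (hP : ∀ k < N, ∀ τ, I k τ → Reaches P τ B fun τ' => I (k + 1) (τ'.set a i 0 (τ' a i 0 + 1)))
    {σ : Memory} (h0 : I 0 (σ.set a i 0 0)) :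
    Reaches (forLoop a i P) σ (11 + N * (B + 15)) (I N) := by
  have key : ∀ m k, k + m = N → ∀ τ, I k τ → Reaches (.loop (cell a i) (cell 4 (-1))
      (.seq P (Diamond.put a i (.add (cell a i) (.const 1))))) τ (7 + m * (B + 15)) (I N) := by
    intro m
    induction m with
    | zero =>
      intro k hk τ hτ
      obtain rfl : k = N := by omega
      have := hI k τ hτ
      exact ⟨τ, _, .loop_false (by simp [eval_cell, this]), by simp [cell, Expr.cost], hτ⟩
    | succ m ih =>
      intro k hk τ hτ
      obtain ⟨h1, h2⟩ := hI k τ hτ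
      have h3 : Reaches (.seq P (Diamond.put a i (.add (cell a i) (.const 1)))) τ (B + 8)
          (I (k + 1)) :=
        Reaches.seq ((hP k (by omega) τ hτ).mono le_rfl fun υ hυ =>
          (Reaches.put (by simpa [Expr.eval, eval_cell] using hυ)).mono
            (by simp [cell, Expr.cost]) fun _ h => h)
      obtain ⟨υ, t, hr, ht, hυ⟩ := h3
      obtain ⟨φ, u, hr', hu, hφ⟩ := ih (k + 1) (by omega) υ hυ
      refine ⟨φ, _, .loop_true (by simp only [eval_cell, h1, h2]; omega) hr hr', ?_, hφ⟩
      simp only [cell, Expr.cost]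
      rw [Nat.succ_mul]
      omega
  refine (Reaches.seq (B := 4) ((Reaches.put ?_).mono (by simp [Expr.cost]) fun _ h => h)).mono
    (show 4 + (7 + N * (B + 15)) ≤ _ by omega) fun _ h => h
  exact key N 0 (by omega) _ h0

/-- The array of the machine that holds the matrix `a`.  The arrays `3`, `4` and `5` hold the
variables, a stack and a copy of a matrix. -/
def slot (a : ℕ) : ℕ := if a < 3 then a else a + 3

theorem slot_injective : Function.Injective slot := fun a b h => by
  simp only [slot] at h
  split_ifs at h <;> omega

theorem slot_ne (a : ℕ) : slot a ≠ 3 ∧ slot a ≠ 4 ∧ slot a ≠ 5 := by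
  simp only [slot]
  split_ifs <;> omega

/-- The machine program that writes the value of an expression to the place `s` of the stack. -/
def MExpr.compile : MExpr → ℕ → Program
  | .const z, s => put 4 s (.const z)
  | .idx x, s => put 4 s (cell 3 x)
  | .read a x y, s => put 4 s (.read (slot a) (cell 3 x) (cell 3 y))
  | .add e f, s => .seq (e.compile s) (.seq (f.compile (s + 1))
      (put 4 s (.add (cell 4 s) (cell 4 (s + 1)))))
  | .sub e f, s => .seq (e.compile s) (.seq (f.compile (s + 1))
      (put 4 s (.sub (cell 4 s) (cell 4 (s + 1)))))
  | .ite x y e f, s => .seq (x.compile s) (.seq (y.compile (s + 1))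
      (.ite (cell 4 s) (cell 4 (s + 1)) (e.compile s) (f.compile s)))
  -- Place `s` saves the outer value of the variable, `s + 1` holds the partial sum, and `s + 2` the
  -- current term.
  | .sum x e, s => .seq (put 4 s (cell 3 x)) (.seq (put 4 (s + 1) (.const 0))
      (.seq (forLoop 3 x (.seq (e.compile (s + 2))
        (put 4 (s + 1) (.add (cell 4 (s + 1)) (cell 4 (s + 2))))))
      (.seq (put 3 x (cell 4 s)) (put 4 s (cell 4 (s + 1))))))

/-- A bound for the running time of a compiled expression. -/
def MExpr.time (N : ℕ) : MExpr → ℕ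
  | .const _ => 4
  | .idx _ => 6
  | .read _ _ _ => 10
  | .add e f => e.time N + (f.time N + 10)
  | .sub e f => e.time N + (f.time N + 10)
  | .ite x y e f => x.time N + (y.time N + (7 + (e.time N + f.time N)))
  | .sum _ e => 6 + (4 + (11 + N * (e.time N + 10 + 15) + (6 + 6)))

/-- The memory holds the size, the matrices and the values of the variables. -/
structure Represents {N : ℕ} (σ : ℕ → Fin N → Fin N → ℤ) (ρ : ℕ → Fin N) (τ : Memory) : Prop where
  size : τ 4 (-1) 0 = N
  matrix : ∀ a (i j : Fin N), τ (slot a) ((i : ℕ) : ℤ) ((j : ℕ) : ℤ) = σ a i j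
  var : ∀ x : ℕ, τ 3 x 0 = ((ρ x : ℕ) : ℤ)

/-- The memories `τ` and `τ'` agree outside of the places of the stack from `s` on. -/
structure Frame (s : ℕ) (τ τ' : Memory) : Prop where
  array : ∀ a, a ≠ 4 → τ' a = τ a
  stack : ∀ i j : ℤ, i < s → τ' 4 i j = τ 4 i j

theorem Frame.refl (s : ℕ) (τ : Memory) : Frame s τ τ := ⟨fun _ _ => rfl, fun _ _ _ => rfl⟩

theorem Frame.trans {s s' : ℕ} {τ τ' τ'' : Memory} (h : Frame s τ τ') (h' : Frame s' τ' τ'')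
    (hs : s ≤ s') : Frame s τ τ'' :=
  ⟨fun a ha => (h'.array a ha).trans (h.array a ha),
    fun i j hi => (h'.stack i j (by omega)).trans (h.stack i j hi)⟩

theorem Frame.set {s s' : ℕ} {τ τ' : Memory} (h : Frame s τ τ') (hs : s ≤ s') (z : ℤ) :
    Frame s τ (τ'.set 4 s' 0 z) := by
  refine ⟨fun a ha => ?_, fun i j hi => ?_⟩
  · rw [← h.array a ha]
    funext i j
    simp [Memory.set, ha]
  · rw [← h.stack i j hi]
    simp only [Memory.set]
    rw [if_neg (by omega)]

theorem Represents.frame {N : ℕ} {σ : ℕ → Fin N → Fin N → ℤ} {ρ : ℕ → Fin N} {s : ℕ}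
    {τ τ' : Memory} (h : Represents σ ρ τ) (hf : Frame s τ τ') : Represents σ ρ τ' := by
  refine ⟨?_, fun a i j => ?_, fun x => ?_⟩
  · rw [hf.stack _ _ (by omega), h.size]
  · rw [hf.array _ (slot_ne a).2.1, h.matrix]
  · rw [hf.array _ (by omega), h.var]

theorem set_self (τ : Memory) (a : ℕ) (i j z : ℤ) : (τ.set a i j z) a i j = z := by
  simp [Memory.set]

theorem set_of_ne (τ : Memory) {a a' : ℕ} {i j z i' j' : ℤ} (h : a' ≠ a ∨ i' ≠ i) :
    (τ.set a i j z) a' i' j' = τ a' i' j' := by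
  simp only [Memory.set]
  rw [if_neg (by tauto)]

theorem set_of_ne_array (τ : Memory) {a a' : ℕ} {i j z : ℤ} (h : a' ≠ a) :
    (τ.set a i j z) a' = τ a' := by
  funext i' j'
  exact set_of_ne τ (Or.inl h)

theorem Represents.set_var {N : ℕ} {σ : ℕ → Fin N → Fin N → ℤ} {ρ : ℕ → Fin N} {τ : Memory}
    (h : Represents σ ρ τ) (x : ℕ) (i : Fin N) :
    Represents σ (Function.update ρ x i) (τ.set 3 x 0 ((i : ℕ) : ℤ)) := by
  refine ⟨?_, fun a i j => ?_, fun y => ?_⟩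
  · rw [set_of_ne _ (by simp), h.size]
  · rw [set_of_ne_array _ (slot_ne a).1, h.matrix]
  · by_cases hy : y = x
    · subst hy
      rw [set_self, Function.update_self]
    · rw [set_of_ne _ (by right; exact_mod_cast hy), Function.update_of_ne hy, h.var]

/-- Code compiled for the place `s` changes nothing lasting outside the stack from `s` on. So an
operand at `s` survives the evaluation of the next one at `s + 1`, and the size, stored at the place
`-1`, is never lost. -/
theorem MExpr.reaches_compile {N : ℕ} {σ : ℕ → Fin N → Fin N → ℤ} (e : MExpr) (s : ℕ)
    (ρ : ℕ → Fin N) (τ : Memory) (h : Represents σ ρ τ) :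
    Reaches (e.compile s) τ (e.time N)
      fun τ' => τ' 4 s 0 = e.eval σ ρ ∧ Frame s τ τ' := by
  induction e generalizing s ρ τ with
  | const z =>
    exact Reaches.put ⟨set_self .., (Frame.refl s τ).set le_rfl _⟩
  | idx x =>
    refine Reaches.put ⟨?_, (Frame.refl s τ).set le_rfl _⟩
    rw [set_self, eval_cell, h.var]
    rfl
  | read a x y =>
    refine Reaches.put ⟨?_, (Frame.refl s τ).set le_rfl _⟩
    rw [set_self]
    simp only [Expr.eval, eval_cell, h.var, h.matrix, MExpr.eval]
  | add e f he hf =>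
    refine Reaches.seq ((he s ρ τ h).mono le_rfl fun τ₁ h₁ => ?_)
    refine Reaches.seq ((hf (s + 1) ρ τ₁ (h.frame h₁.2)).mono le_rfl fun τ₂ h₂ => ?_)
    refine Reaches.put ⟨?_, (h₁.2.trans h₂.2 (by omega)).set le_rfl _⟩
    rw [set_self]
    have h₃ := h₂.2.stack s 0 (by omega)
    have h₄ := h₂.1
    push_cast at h₄
    simp only [Expr.eval, eval_cell, h₃, h₄, h₁.1, MExpr.eval]
  | sub e f he hf =>
    refine Reaches.seq ((he s ρ τ h).mono le_rfl fun τ₁ h₁ => ?_)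
    refine Reaches.seq ((hf (s + 1) ρ τ₁ (h.frame h₁.2)).mono le_rfl fun τ₂ h₂ => ?_)
    refine Reaches.put ⟨?_, (h₁.2.trans h₂.2 (by omega)).set le_rfl _⟩
    rw [set_self]
    have h₃ := h₂.2.stack s 0 (by omega)
    have h₄ := h₂.1
    push_cast at h₄
    simp only [Expr.eval, eval_cell, h₃, h₄, h₁.1, MExpr.eval]
  | ite x y e f hx hy he hf =>
    refine Reaches.seq ((hx s ρ τ h).mono le_rfl fun τ₁ h₁ => ?_)
    refine Reaches.seq ((hy (s + 1) ρ τ₁ (h.frame h₁.2)).mono le_rfl fun τ₂ h₂ => ?_)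
    have hfr := h₁.2.trans h₂.2 (by omega)
    have h₃ := h₂.2.stack s 0 (by omega)
    have h₄ := h₂.1
    push_cast at h₄
    refine Reaches.ite (fun hlt => (he s ρ τ₂ (h.frame hfr)).mono le_rfl fun τ₃ h₅ => ?_)
      fun hlt => (hf s ρ τ₂ (h.frame hfr)).mono le_rfl fun τ₃ h₅ => ?_
    · simp only [eval_cell, h₃, h₄, h₁.1] at hlt
      exact ⟨by simp only [MExpr.eval, if_pos hlt, h₅.1], hfr.trans h₅.2 le_rfl⟩
    · simp only [eval_cell, h₃, h₄, h₁.1] at hlt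
      exact ⟨by simp only [MExpr.eval, if_neg hlt, h₅.1], hfr.trans h₅.2 le_rfl⟩
  | sum x e he =>
    -- The variable `x` serves as the loop counter, so the memory agrees with `τ` below the stack
    -- only after the old value of `x` is put back.
    let I : ℕ → Memory → Prop := fun k υ => υ 3 x 0 = k ∧
      υ 4 s 0 = ((ρ x : ℕ) : ℤ) ∧
      υ 4 (s + 1) 0 = ∑ i : Fin N, (if (i : ℕ) < k then e.eval σ (Function.update ρ x i) else 0) ∧
      Frame s τ (υ.set 3 x 0 ((ρ x : ℕ) : ℤ))
    have hframe : ∀ {υ : Memory} {s' : ℕ} (z w : ℤ), s ≤ s' →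
        Frame s τ (υ.set 3 x 0 z) → Frame s τ ((υ.set 4 s' 0 w).set 3 x 0 z) := by
      intro υ s' z w hs hυ
      have := hυ.set hs w
      refine ⟨fun a ha => ?_, fun i j hi => ?_⟩
      · rw [← this.array a ha]
        funext i j
        simp [Memory.set, ha]
      · rw [← this.stack i j hi]
        simp [Memory.set]
    have hset : ∀ {υ : Memory} (z : ℤ), Frame s τ (υ.set 3 x 0 ((ρ x : ℕ) : ℤ)) →
        Frame s τ ((υ.set 3 x 0 z).set 3 x 0 ((ρ x : ℕ) : ℤ)) := by
      intro υ z hυ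
      have : (υ.set 3 x 0 z).set 3 x 0 ((ρ x : ℕ) : ℤ) = υ.set 3 x 0 ((ρ x : ℕ) : ℤ) := by
        funext a i j
        simp only [Memory.set]
        split_ifs <;> rfl
      rwa [this]
    have hback : Frame s τ (τ.set 3 x 0 ((ρ x : ℕ) : ℤ)) := by
      refine ⟨fun a _ => ?_, fun i j _ => set_of_ne _ (by simp)⟩
      funext i j
      simp only [Memory.set]
      split_ifs with hc
      · rw [hc.1, hc.2.1, hc.2.2, h.var]
      · rfl
    refine Reaches.seq (Reaches.put (Reaches.seq (Reaches.put (Reaches.seq ?_))))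
    refine (Reaches.forLoop I (fun k υ hυ => ⟨hυ.1, ?_⟩) (fun k hk υ hυ => ?_) ?_).mono le_rfl
      fun υ hυ => ?_
    · have := hυ.2.2.2.stack (-1) 0 (by omega)
      rw [set_of_ne _ (by simp)] at this
      rw [this, h.size]
    · obtain ⟨h1, h2, h3, h4⟩ := hυ
      have hrep : Represents σ (Function.update ρ x ⟨k, hk⟩) υ := by
        have := (h.frame h4).set_var x ⟨k, hk⟩
        have e : ((υ.set 3 x 0 ((ρ x : ℕ) : ℤ)).set 3 x 0 (((⟨k, hk⟩ : Fin N) : ℕ) : ℤ)) = υ := by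
          funext a i j
          simp only [Memory.set]
          split_ifs with hc
          · rw [hc.1, hc.2.1, hc.2.2, h1]
          · rfl
        rwa [e] at this
      refine Reaches.seq ((he (s + 2) _ υ hrep).mono le_rfl fun υ₁ k1 => Reaches.put ?_)
      obtain ⟨k1, k2⟩ := k1
      push_cast at k1
      have k3 := k2.stack s 0 (by omega)
      have k4 := k2.stack (s + 1) 0 (by omega)
      have k5 : υ₁ 3 x 0 = k := by rw [k2.array 3 (by omega), h1]
      have k6 : Frame s τ (υ₁.set 3 x 0 ((ρ x : ℕ) : ℤ)) := by
        refine ⟨fun a ha => ?_, fun i j hi => ?_⟩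
        · rw [← h4.array a ha]
          funext i j
          simp only [Memory.set, k2.array a ha]
        · rw [← h4.stack i j hi, set_of_ne _ (by simp), set_of_ne _ (by simp),
            k2.stack i j (by omega)]
      refine ⟨?_, ?_, ?_, hset _ (by
        have := hframe ((ρ x : ℕ) : ℤ)
          ((Expr.add (cell 4 (s + 1)) (cell 4 (s + 2))).eval υ₁) (Nat.le_succ s) k6
        push_cast at this
        exact this)⟩
      · rw [set_self, set_of_ne _ (by simp), k5]
        push_cast
        rfl
      · rw [set_of_ne _ (by simp), set_of_ne _ (by right; omega), k3, h2]
      · rw [set_of_ne _ (by simp), set_self]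
        simp only [Expr.eval, eval_cell]
        rw [k1, k4, h3]
        have : e.eval σ (Function.update ρ x ⟨k, hk⟩) =
            ∑ i : Fin N, if (i : ℕ) = k then e.eval σ (Function.update ρ x i) else 0 := by
          rw [Finset.sum_eq_single ⟨k, hk⟩]
          · simp
          · intro b _ hb
            rw [if_neg]
            exact fun hbk => hb (Fin.ext hbk)
          · simp
        rw [this, ← Finset.sum_add_distrib]
        refine Finset.sum_congr rfl fun i _ => ?_
        by_cases hi : (i : ℕ) = k
        · simp [hi]
        · have : (i : ℕ) < k + 1 ↔ (i : ℕ) < k := by omega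
          simp [hi, this]
    · refine ⟨set_self .., ?_, ?_, hset _ ?_⟩
      · rw [set_of_ne _ (by simp), set_of_ne _ (by right; omega), set_self, eval_cell, h.var]
      · rw [set_of_ne _ (by simp), set_self]
        simp [Expr.eval]
      · have := hframe (s' := s + 1) ((ρ x : ℕ) : ℤ) ((Expr.const 0).eval τ) (Nat.le_succ s)
          (hframe ((ρ x : ℕ) : ℤ) ((cell 3 x).eval τ) le_rfl hback)
        push_cast at this
        exact this
    · refine Reaches.seq (Reaches.put (Reaches.put ⟨?_, ?_⟩))
      · rw [set_self, eval_cell, set_of_ne _ (by simp), hυ.2.2.1]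
        simp [MExpr.eval]
      · rw [eval_cell, hυ.2.1]
        exact hυ.2.2.2.set le_rfl _

/-- The machine program that executes a matrix program; it uses the stack from the place `s` on. -/
def MProgram.compile : MProgram → ℕ → Program
  -- The entries go to array `5` first and are copied afterwards, because `e` may read the matrix
  -- `a` that is being replaced.
  | .fill a e, s => .seq (forLoop 3 0 (forLoop 3 1 (.seq (e.compile s)
        (.write 5 (cell 3 0) (cell 3 1) (cell 4 s)))))
      (.seq (forLoop 3 0 (forLoop 3 1 (.write (slot a) (cell 3 0) (cell 3 1)
        (.read 5 (cell 3 0) (cell 3 1)))))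
      (.seq (put 3 0 (.const 0)) (put 3 1 (.const 0))))
  | .seq P Q, s => .seq (P.compile s) (Q.compile s)
  | .rep P, s => forLoop 4 s (P.compile (s + 1))

/-- A bound for the running time of a compiled matrix program. -/
def MProgram.time (N : ℕ) : MProgram → ℕ
  | .fill _ e => (11 + N * ((11 + N * ((e.time N + 10) + 15)) + 15)) +
      ((11 + N * ((11 + N * (14 + 15)) + 15)) + (4 + 4))
  | .seq P Q => P.time N + Q.time N
  | .rep P => 11 + N * (P.time N + 15)

/-- Here `I i j` describes the state before entry `(i, j)`, in row order. It must not depend on the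
two counters (`hset`), and the end of a row counts as the start of the next (`hrow`). -/
theorem Reaches.forLoop_forLoop {P : Program} {N B : ℕ} (I : ℕ → ℕ → Memory → Prop)
    (hset : ∀ i j υ (x : ℕ) z, x < 2 → I i j υ → I i j (υ.set 3 x 0 z))
    (hsize : ∀ i j υ, I i j υ → υ 4 (-1) 0 = N)
    (hrow : ∀ i υ, I i N υ → I (i + 1) 0 υ)
    (hP : ∀ i < N, ∀ j < N, ∀ υ, I i j υ → υ 3 0 0 = i → υ 3 1 0 = j → Reaches P υ B
      fun υ' => I i (j + 1) υ' ∧ υ' 3 0 0 = i ∧ υ' 3 1 0 = j)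
    {σ : Memory} (h0 : I 0 0 σ) :
    Reaches (Diamond.forLoop 3 0 (Diamond.forLoop 3 1 P)) σ
      (11 + N * ((11 + N * (B + 15)) + 15)) (I N 0) := by
  refine (Reaches.forLoop (fun i υ => υ 3 0 0 = i ∧ I i 0 υ) (fun k υ hυ => ⟨hυ.1, hsize _ _ _ hυ.2⟩)
    (fun i hi υ hυ => ?_) ⟨set_self .., hset 0 0 _ 0 0 (by omega) h0⟩).mono le_rfl fun _ h => h.2
  refine (Reaches.forLoop (fun j υ => υ 3 1 0 = j ∧ υ 3 0 0 = i ∧ I i j υ)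
    (fun k υ hυ => ⟨hυ.1, hsize _ _ _ hυ.2.2⟩) (fun j hj υ hυ => ?_)
    ⟨set_self .., ?_, hset i 0 _ 1 0 (by omega) hυ.2⟩).mono le_rfl fun υ hυ => ?_
  · refine (hP i hi j hj υ hυ.2.2 hυ.2.1 hυ.1).mono le_rfl fun υ' hυ' => ⟨?_, ?_, ?_⟩
    · rw [set_self, hυ'.2.2]
      push_cast
      rfl
    · rw [set_of_ne _ (by simp), hυ'.2.1]
    · exact hset _ _ _ 1 _ (by omega) hυ'.1
  · rw [set_of_ne _ (by simp), hυ.1]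
  · refine ⟨?_, hset _ _ _ 0 _ (by omega) (hrow i υ hυ.2.2)⟩
    rw [set_self, hυ.2.1]
    push_cast
    rfl

/-- The entries that come before the entry `(i, j)` in the order in which matrices are filled. -/
def Before {N : ℕ} (i j : ℕ) (i' j' : Fin N) : Prop := (i' : ℕ) < i ∨ ((i' : ℕ) = i ∧ (j' : ℕ) < j)

theorem MProgram.reaches_compile {N : ℕ} [NeZero N] (P : MProgram) (s : ℕ)
    (σ : ℕ → Fin N → Fin N → ℤ) (τ : Memory) (h : Represents σ (fun _ => 0) τ) :
    Reaches (P.compile s) τ (P.time N) fun τ' =>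
      Represents (P.exec σ) (fun _ => 0) τ' ∧ ∀ i j : ℤ, i < s → τ' 4 i j = τ 4 i j := by
  induction P generalizing s σ τ with
  | seq P Q hP hQ =>
    refine Reaches.seq ((hP s σ τ h).mono le_rfl fun τ₁ h₁ => ?_)
    exact (hQ s _ τ₁ h₁.1).mono le_rfl fun τ₂ h₂ =>
      ⟨h₂.1, fun i j hi => (h₂.2 i j hi).trans (h₁.2 i j hi)⟩
  | rep P hP =>
    refine (Reaches.forLoop (fun k υ => υ 4 s 0 = k ∧ Represents (P.exec^[k] σ) (fun _ => 0) υ ∧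
      ∀ i j : ℤ, i < s → υ 4 i j = τ 4 i j) (fun k υ hυ => ⟨hυ.1, hυ.2.1.size⟩)
      (fun k hk υ hυ => ?_) ⟨set_self .., ?_, ?_⟩).mono le_rfl fun _ h => h.2
    · refine (hP (s + 1) _ υ hυ.2.1).mono le_rfl fun υ' hυ' => ⟨?_, ?_, fun i j hi => ?_⟩
      · rw [set_self, hυ'.2 _ _ (by omega), hυ.1]
        push_cast
        rfl
      · rw [Function.iterate_succ_apply']
        exact hυ'.1.frame (((Frame.refl 0 υ').set (Nat.zero_le s) _))
      · rw [set_of_ne _ (by right; omega), hυ'.2 _ _ (by omega), hυ.2.2 i j hi]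
    · exact h.frame ((Frame.refl 0 τ).set (Nat.zero_le s) _)
    · intro i j hi
      rw [set_of_ne _ (by right; omega)]
  | fill a e =>
    have hslot := slot_ne a
    let val : Fin N → Fin N → ℤ := fun i j => e.eval σ (entryEnv i j)
    let I : ℕ → ℕ → Memory → Prop := fun i j υ =>
      υ 4 (-1) 0 = N ∧ (∀ b (i j : Fin N), υ (slot b) ((i : ℕ) : ℤ) ((j : ℕ) : ℤ) = σ b i j) ∧
      (∀ x : ℕ, 2 ≤ x → υ 3 x 0 = 0) ∧ (∀ i j : ℤ, i < s → υ 4 i j = τ 4 i j) ∧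
      ∀ i' j' : Fin N, Before i j i' j' → υ 5 ((i' : ℕ) : ℤ) ((j' : ℕ) : ℤ) = val i' j'
    -- During the copying, array `5` is complete, and the matrix `a` is known only at the entries
    -- copied so far.
    let I' : ℕ → ℕ → Memory → Prop := fun i j υ =>
      υ 4 (-1) 0 = N ∧
      (∀ b (i j : Fin N), b ≠ a → υ (slot b) ((i : ℕ) : ℤ) ((j : ℕ) : ℤ) = σ b i j) ∧
      (∀ x : ℕ, 2 ≤ x → υ 3 x 0 = 0) ∧ (∀ i j : ℤ, i < s → υ 4 i j = τ 4 i j) ∧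
      (∀ i' j' : Fin N, υ 5 ((i' : ℕ) : ℤ) ((j' : ℕ) : ℤ) = val i' j') ∧
      ∀ i' j' : Fin N, Before i j i' j' → υ (slot a) ((i' : ℕ) : ℤ) ((j' : ℕ) : ℤ) = val i' j'
    refine Reaches.seq ((Reaches.forLoop_forLoop (B := e.time N + 10) I ?_ (fun _ _ _ h => h.1) ?_ ?_
      ?_).mono le_rfl fun υ hυ => ?_)
    · intro i j υ x z hx hυ
      refine ⟨?_, fun b i' j' => ?_, fun y hy => ?_, fun i' j' hi => ?_, fun i' j' hij => ?_⟩
      · rw [set_of_ne _ (by simp), hυ.1]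
      · rw [set_of_ne_array _ (slot_ne b).1, hυ.2.1]
      · rw [set_of_ne _ (by right; omega), hυ.2.2.1 y hy]
      · rw [set_of_ne _ (by simp), hυ.2.2.2.1 i' j' hi]
      · rw [set_of_ne _ (by simp), hυ.2.2.2.2 i' j' hij]
    · intro i υ hυ
      refine ⟨hυ.1, hυ.2.1, hυ.2.2.1, hυ.2.2.2.1, fun i' j' hij => hυ.2.2.2.2 i' j' ?_⟩
      have := j'.2
      simp only [Before] at hij ⊢
      omega
    · intro i hi j hj υ hυ h0 h1
      have hrep : Represents σ (entryEnv ⟨i, hi⟩ ⟨j, hj⟩) υ := by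
        refine ⟨hυ.1, hυ.2.1, fun x => ?_⟩
        rcases Nat.lt_or_ge x 2 with hx | hx
        · interval_cases x
          · simpa [entryEnv] using h0
          · simpa [entryEnv] using h1
        · rw [hυ.2.2.1 x hx, entryEnv, Function.update_of_ne (by omega),
            Function.update_of_ne (by omega)]
          simp
      refine Reaches.seq ((e.reaches_compile s _ υ hrep).mono le_rfl fun υ' hυ' => ?_)
      obtain ⟨hval, hfr⟩ := hυ'
      have h0' : υ' 3 0 0 = i := by rw [hfr.array 3 (by omega), h0]
      have h1' : υ' 3 1 0 = j := by rw [hfr.array 3 (by omega), h1]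
      refine (Reaches.write ?_).mono (by simp [cell, Expr.cost]) fun _ h => h
      simp only [eval_cell, h0', h1', hval]
      refine ⟨⟨?_, fun b i' j' => ?_, fun y hy => ?_, fun i' j' hi => ?_, fun i' j' hij => ?_⟩, ?_, ?_⟩
      · rw [set_of_ne _ (by simp), hfr.stack _ _ (by omega), hυ.1]
      · rw [set_of_ne_array _ (slot_ne b).2.2, hfr.array _ (slot_ne b).2.1, hυ.2.1]
      · rw [set_of_ne _ (by simp), hfr.array _ (by omega), hυ.2.2.1 y hy]
      · rw [set_of_ne _ (by simp), hfr.stack _ _ hi, hυ.2.2.2.1 i' j' hi]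
      · by_cases heq : (i' : ℕ) = i ∧ (j' : ℕ) = j
        · obtain ⟨rfl, rfl⟩ := heq
          rw [set_self]
        · have hb : Before i j i' j' := by
            simp only [Before] at hij ⊢
            omega
          rw [← hυ.2.2.2.2 i' j' hb, ← hfr.array 5 (by omega)]
          simp only [Memory.set]
          rw [if_neg]
          simpa using heq
      · rw [set_of_ne _ (by simp), h0']
      · rw [set_of_ne _ (by simp), h1']
    · exact ⟨h.size, h.matrix, fun x _ => by simpa using h.var x, fun _ _ _ => rfl,
        fun i' j' hij => by simp [Before] at hij⟩
    refine Reaches.seq ((Reaches.forLoop_forLoop (B := 14) I' ?_ (fun _ _ _ h => h.1) ?_ ?_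
      ?_).mono le_rfl fun υ hυ => ?_)
    · intro i j υ x z hx hυ
      refine ⟨?_, fun b i' j' hb => ?_, fun y hy => ?_, fun i' j' hi => ?_, fun i' j' => ?_,
        fun i' j' hij => ?_⟩
      · rw [set_of_ne _ (by simp), hυ.1]
      · rw [set_of_ne_array _ (slot_ne b).1, hυ.2.1 _ _ _ hb]
      · rw [set_of_ne _ (by right; omega), hυ.2.2.1 y hy]
      · rw [set_of_ne _ (by simp), hυ.2.2.2.1 i' j' hi]
      · rw [set_of_ne _ (by simp), hυ.2.2.2.2.1 i' j']
      · rw [set_of_ne_array _ hslot.1, hυ.2.2.2.2.2 i' j' hij]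
    · intro i υ hυ
      refine ⟨hυ.1, hυ.2.1, hυ.2.2.1, hυ.2.2.2.1, hυ.2.2.2.2.1,
        fun i' j' hij => hυ.2.2.2.2.2 i' j' ?_⟩
      have := j'.2
      simp only [Before] at hij ⊢
      omega
    · intro i hi j hj υ hυ h0 h1
      refine (Reaches.write ?_).mono (by simp [cell, Expr.cost]) fun _ h => h
      have hv := hυ.2.2.2.2.1 ⟨i, hi⟩ ⟨j, hj⟩
      simp only at hv
      simp only [Expr.eval, eval_cell, h0, h1, hv]
      refine ⟨⟨?_, fun b i' j' hb => ?_, fun y hy => ?_, fun i' j' hi => ?_, fun i' j' => ?_,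
        fun i' j' hij => ?_⟩, ?_, ?_⟩
      · rw [set_of_ne_array _ hslot.2.1.symm, hυ.1]
      · rw [set_of_ne_array _ (slot_injective.ne hb), hυ.2.1 _ _ _ hb]
      · rw [set_of_ne_array _ hslot.1.symm, hυ.2.2.1 y hy]
      · rw [set_of_ne_array _ hslot.2.1.symm, hυ.2.2.2.1 i' j' hi]
      · rw [set_of_ne_array _ hslot.2.2.symm, hυ.2.2.2.2.1 i' j']
      · by_cases heq : (i' : ℕ) = i ∧ (j' : ℕ) = j
        · obtain ⟨rfl, rfl⟩ := heq
          rw [set_self]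
        · have hb : Before i j i' j' := by
            simp only [Before] at hij ⊢
            omega
          rw [← hυ.2.2.2.2.2 i' j' hb]
          simp only [Memory.set]
          rw [if_neg]
          simpa using heq
      · rw [set_of_ne_array _ hslot.1.symm, h0]
      · rw [set_of_ne_array _ hslot.1.symm, h1]
    · exact ⟨hυ.1, fun b i j _ => hυ.2.1 b i j, hυ.2.2.1, hυ.2.2.2.1,
        fun i' j' => hυ.2.2.2.2 i' j' (Or.inl i'.2), fun i' j' hij => by simp [Before] at hij⟩
    refine Reaches.seq (Reaches.put (Reaches.put ⟨⟨?_, fun b i j => ?_, fun x => ?_⟩,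
      fun i j hi => ?_⟩))
    · rw [set_of_ne _ (by simp), set_of_ne _ (by simp), hυ.1]
    · rw [set_of_ne_array _ (slot_ne b).1, set_of_ne_array _ (slot_ne b).1, MProgram.exec]
      by_cases hb : b = a
      · subst hb
        rw [hυ.2.2.2.2.2 i j (Or.inl i.2), Function.update_self]
      · rw [hυ.2.1 _ _ _ hb, Function.update_of_ne hb]
    · simp only [Expr.eval, Fin.val_zero, Nat.cast_zero]
      rcases Nat.lt_or_ge x 2 with hx | hx
      · interval_cases x
        · rw [set_of_ne _ (by simp)]
          exact set_self ..
        · exact set_self ..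
      · rw [set_of_ne _ (by right; omega), set_of_ne _ (by right; omega), hυ.2.2.1 x hx]
    · rw [set_of_ne _ (by simp), set_of_ne _ (by simp), hυ.2.2.2.1 i j hi]

theorem MExpr.exists_polynomial (e : MExpr) : ∃ b : Polynomial ℕ, ∀ N, e.time N = b.eval N := by
  induction e with
  | const z => exact ⟨4, fun N => by simp [MExpr.time]⟩
  | idx x => exact ⟨6, fun N => by simp [MExpr.time]⟩
  | read a x y => exact ⟨10, fun N => by simp [MExpr.time]⟩
  | add e f he hf =>
    obtain ⟨b, hb⟩ := he
    obtain ⟨d, hd⟩ := hf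
    exact ⟨b + (d + 10), fun N => by simp [MExpr.time, hb, hd]⟩
  | sub e f he hf =>
    obtain ⟨b, hb⟩ := he
    obtain ⟨d, hd⟩ := hf
    exact ⟨b + (d + 10), fun N => by simp [MExpr.time, hb, hd]⟩
  | ite x y e f hx hy he hf =>
    obtain ⟨b, hb⟩ := he
    obtain ⟨d, hd⟩ := hf
    obtain ⟨b', hb'⟩ := hx
    obtain ⟨d', hd'⟩ := hy
    exact ⟨b' + (d' + (7 + (b + d))), fun N => by simp [MExpr.time, hb, hd, hb', hd']⟩
  | sum x e he =>
    obtain ⟨b, hb⟩ := he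
    exact ⟨6 + (4 + (11 + .X * (b + 10 + 15) + (6 + 6))), fun N => by simp [MExpr.time, hb]⟩

theorem MProgram.exists_polynomial (P : MProgram) :
    ∃ b : Polynomial ℕ, ∀ N, P.time N = b.eval N := by
  induction P with
  | fill a e =>
    obtain ⟨b, hb⟩ := e.exists_polynomial
    exact ⟨(11 + .X * ((11 + .X * ((b + 10) + 15)) + 15)) +
      ((11 + .X * ((11 + .X * (14 + 15)) + 15)) + (4 + 4)), fun N => by simp [MProgram.time, hb]⟩
  | seq P Q hP hQ =>
    obtain ⟨b, hb⟩ := hP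
    obtain ⟨d, hd⟩ := hQ
    exact ⟨b + d, fun N => by simp [MProgram.time, hb, hd]⟩
  | rep P hP =>
    obtain ⟨b, hb⟩ := hP
    exact ⟨11 + .X * (b + 15), fun N => by simp [MProgram.time, hb]⟩

/-- The matrices of the input. -/
noncomputable def inputMatrices {n : ℕ} (G : SimpleGraph (Fin n)) (k : ℕ) (a : ℕ) (i j : Fin n) :
    ℤ :=
  input G k (slot a) ((i : ℕ) : ℤ) ((j : ℕ) : ℤ)

/-- Matrix programs can be executed in polynomial time; graphs with at most one vertex are treated
separately. -/
theorem MProgram.exists_program (P : MProgram) : ∃ (Q : Program) (b : Polynomial ℕ),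
    ∀ (n k : ℕ) (G : SimpleGraph (Fin n)), ∃ (τ : Memory) (t : ℕ),
      Runs Q (input G k) τ t ∧ t ≤ b.eval n ∧
      (n < 2 → τ = (input G k).set 0 0 0 1) ∧
      ∀ (_ : NeZero n), 2 ≤ n → ∀ a (i j : Fin n),
        τ (slot a) ((i : ℕ) : ℤ) ((j : ℕ) : ℤ) = P.exec (inputMatrices G k) a i j := by
  obtain ⟨b, hb⟩ := P.exists_polynomial
  -- The size is copied to the place `-1` of the stack, where the loops look for it; array `0` may
  -- be overwritten later.
  refine ⟨.ite (cell 0 0) (.const 2) (put 0 0 (.const 1)) (.seq (put 4 (-1) (cell 0 0)) (P.compile 0)),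
    3 + 1 + 1 + (4 + (6 + b)), fun n k G => ?_⟩
  have h0 : (cell 0 0).eval (input G k) = n := by simp [eval_cell, input]
  suffices h : Reaches _ (input G k) (3 + 1 + 1 + (4 + (6 + P.time n))) _ by
    obtain ⟨τ, t, hr, ht, hp⟩ := h
    exact ⟨τ, t, hr, by simpa [← hb] using ht, hp⟩
  refine Reaches.ite (fun hlt => ?_) fun hlt => ?_
  · rw [h0] at hlt
    simp only [Expr.eval] at hlt
    exact Reaches.put ⟨fun _ => rfl, fun _ hn => by omega⟩
  · rw [h0] at hlt
    simp only [Expr.eval] at hlt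
    have hnz : NeZero n := ⟨by omega⟩
    refine Reaches.seq (Reaches.put ?_)
    refine (P.reaches_compile 0 (inputMatrices G k) _ ⟨?_, fun a i j => ?_, fun x => ?_⟩).mono le_rfl
      fun τ hτ => ⟨fun hn => by omega, fun _ hn a i j => hτ.1.matrix a i j⟩
    · rw [set_self, h0]
    · rw [set_of_ne_array _ (slot_ne a).2.1]
      rfl
    · rw [set_of_ne _ (by simp)]
      simp [input]

/-! ### Conditions in matrix programs -/

/-- The condition that an expression expresses: its value is positive. -/
def MExpr.Holds {N : ℕ} (σ : ℕ → Fin N → Fin N → ℤ) (ρ : ℕ → Fin N) (e : MExpr) : Prop :=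
  0 < e.eval σ ρ

/-- The value of `e` if the condition `b` holds, and of `f` otherwise. -/
def MExpr.cond (b e f : MExpr) : MExpr := .ite (.const 0) b e f

/-- The condition `x < y`. -/
def MExpr.lt (x y : MExpr) : MExpr := .ite x y (.const 1) (.const 0)

/-- Negation. -/
def MExpr.not (b : MExpr) : MExpr := b.cond (.const 0) (.const 1)

/-- Conjunction. -/
def MExpr.and (b d : MExpr) : MExpr := b.cond d (.const 0)

/-- Disjunction. -/
def MExpr.or (b d : MExpr) : MExpr := b.cond (.const 1) d

/-- Existential quantification. -/
def MExpr.any (x : ℕ) (b : MExpr) : MExpr := .sum x (b.cond (.const 1) (.const 0))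

/-- Universal quantification. -/
def MExpr.all (x : ℕ) (b : MExpr) : MExpr := (MExpr.any x b.not).not

/-- The condition `x = y`. -/
def MExpr.eq (x y : MExpr) : MExpr := (x.lt y).not.and (y.lt x).not

/-- One if the condition holds, and zero otherwise. -/
def MExpr.ind (b : MExpr) : MExpr := b.cond (.const 1) (.const 0)

section Conditions

variable {N : ℕ} {σ : ℕ → Fin N → Fin N → ℤ} {ρ : ℕ → Fin N}

open Classical in
theorem eval_cond (b e f : MExpr) :
    (b.cond e f).eval σ ρ = if b.Holds σ ρ then e.eval σ ρ else f.eval σ ρ := by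
  simp only [MExpr.cond, MExpr.eval, MExpr.Holds]
  congr

open Classical in
theorem eval_ind (b : MExpr) : b.ind.eval σ ρ = if b.Holds σ ρ then 1 else 0 :=
  eval_cond b _ _

theorem holds_lt (x y : MExpr) : (x.lt y).Holds σ ρ ↔ x.eval σ ρ < y.eval σ ρ := by
  simp only [MExpr.lt, MExpr.Holds, MExpr.eval]
  split_ifs with h <;> simp [h]

theorem holds_not (b : MExpr) : b.not.Holds σ ρ ↔ ¬ b.Holds σ ρ := by
  rw [MExpr.Holds, MExpr.not, eval_cond]
  split_ifs with h <;> simp [h, MExpr.eval]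

theorem holds_and (b d : MExpr) : (b.and d).Holds σ ρ ↔ b.Holds σ ρ ∧ d.Holds σ ρ := by
  rw [MExpr.Holds, MExpr.and, eval_cond]
  split_ifs with h <;> simp [h, MExpr.eval]
  rfl

theorem holds_or (b d : MExpr) : (b.or d).Holds σ ρ ↔ b.Holds σ ρ ∨ d.Holds σ ρ := by
  rw [MExpr.Holds, MExpr.or, eval_cond]
  split_ifs with h <;> simp [h, MExpr.eval]
  rfl

theorem holds_any (x : ℕ) (b : MExpr) :
    (b.any x).Holds σ ρ ↔ ∃ i, b.Holds σ (Function.update ρ x i) := by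
  classical
  simp only [MExpr.any]
  rw [MExpr.Holds]
  simp only [MExpr.eval, eval_cond]
  rw [Finset.sum_boole]
  simp [Finset.card_pos, Finset.filter_nonempty_iff]

theorem holds_all (x : ℕ) (b : MExpr) :
    (b.all x).Holds σ ρ ↔ ∀ i, b.Holds σ (Function.update ρ x i) := by
  simp [MExpr.all, holds_not, holds_any]

theorem holds_eq (x y : MExpr) : (x.eq y).Holds σ ρ ↔ x.eval σ ρ = y.eval σ ρ := by
  simp only [MExpr.eq, holds_and, holds_not, holds_lt]
  omega

theorem holds_read (a x y : ℕ) : (MExpr.read a x y).Holds σ ρ ↔ 0 < σ a (ρ x) (ρ y) :=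
  Iff.rfl

theorem entryEnv_zero [NeZero N] (i j : Fin N) : entryEnv i j 0 = i := by simp [entryEnv]

theorem entryEnv_one [NeZero N] (i j : Fin N) : entryEnv i j 1 = j := by simp [entryEnv]

/-- No quantifier or sum of the algorithm binds the variable `9`, so it is a name for the vertex
zero. -/
theorem entryEnv_nine [NeZero N] (i j : Fin N) : entryEnv i j 9 = 0 := by simp [entryEnv]

end Conditions

/-- The matrices that a matrix program changes. -/
def MProgram.writes : MProgram → List ℕ
  | .fill a _ => [a]
  | .seq P Q => P.writes ++ Q.writes
  | .rep P => P.writes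

/-- With this frame rule, `decide` shows that a later stage leaves an earlier result alone. -/
theorem MProgram.exec_of_notMem {N : ℕ} [NeZero N] (P : MProgram) {a : ℕ} (h : a ∉ P.writes)
    (σ : ℕ → Fin N → Fin N → ℤ) : P.exec σ a = σ a := by
  induction P generalizing σ with
  | fill b e =>
    simp only [writes, List.mem_singleton] at h
    simp [exec, h]
  | seq P Q hP hQ =>
    simp only [writes, List.mem_append, not_or] at h
    rw [exec, hQ h.2, hP h.1]
  | rep P hP =>
    rw [exec]
    have : ∀ k, (P.exec^[k] σ) a = σ a := fun k => by
      induction k with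
      | zero => rfl
      | succ k ih => rw [Function.iterate_succ_apply', hP h, ih]
    exact this N

/-! ### Distances -/

namespace Algorithm

open MExpr MProgram

/-- Initialization of the distances: `3` tells which vertices can be reached, `4` holds the lower
bounds found so far, and `5` their parities. -/
def distInit : MProgram :=
  .seq (.fill 3 (ind (eq (idx 0) (idx 1)))) (.seq (.fill 4 (const 0)) (.fill 5 (const 0)))

/-- One round of breadth-first search, for all pairs of vertices. -/
def distStep : MProgram :=
  -- Matrix `3` is updated last, since the other two need the old balls. Parities are maintained
  -- along the way because the language has no division.
  .seq (.fill 5 (cond (read 3 0 1) (read 5 0 1) (sub (const 1) (read 5 0 1))))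
  (.seq (.fill 4 (cond (read 3 0 1) (read 4 0 1) (add (read 4 0 1) (const 1))))
  (.fill 3 (ind (or (read 3 0 1) (any 2 (and (read 3 0 2) (read 2 2 1)))))))

/-- All distances in the graph, and their parities. -/
def distances : MProgram := .seq distInit (.rep distStep)

variable {N : ℕ} [NeZero N] (σ : ℕ → Fin N → Fin N → ℤ)

open Classical in
theorem exec_distInit (i j : Fin N) : distInit.exec σ 3 i j = (if i = j then 1 else 0) ∧
    distInit.exec σ 4 i j = 0 ∧ distInit.exec σ 5 i j = 0 := by
  simp [distInit, exec, eval_ind, holds_eq, eval, entryEnv_zero,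
    entryEnv_one, Fin.ext_iff]

open Classical in
theorem exec_distStep (i j : Fin N) :
    distStep.exec σ 3 i j = (if 0 < σ 3 i j ∨ ∃ k, 0 < σ 3 i k ∧ 0 < σ 2 k j then 1 else 0) ∧
    distStep.exec σ 4 i j = (if 0 < σ 3 i j then σ 4 i j else σ 4 i j + 1) ∧
    distStep.exec σ 5 i j = (if 0 < σ 3 i j then σ 5 i j else 1 - σ 5 i j) := by
  simp [distStep, exec, eval_ind, eval_cond, holds_or, holds_any, holds_and,
    holds_read, eval, entryEnv_zero, entryEnv_one]

theorem edist_le_succ_iff {V : Type*} (G : SimpleGraph V) (u v : V) (t : ℕ) :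
    G.edist u v ≤ (t + 1 : ℕ) ↔ G.edist u v ≤ t ∨ ∃ w, G.edist u w ≤ t ∧ G.Adj w v := by
  constructor
  · intro h
    rcases h.lt_or_eq with h | h
    · left
      obtain ⟨d, hd⟩ := ENat.ne_top_iff_exists.1 (ne_top_of_lt h)
      rw [← hd] at h ⊢
      norm_cast at h ⊢
      omega
    · right
      obtain ⟨p, hp⟩ := SimpleGraph.exists_walk_of_edist_eq_coe h
      obtain ⟨q, hq⟩ : ∃ q : G.Walk v u, q.length = t + 1 := ⟨p.reverse, by simpa using hp⟩
      cases q with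
      | nil => simp at hq
      | @cons _ w _ hadj q =>
        refine ⟨w, ?_, hadj.symm⟩
        rw [SimpleGraph.edist_comm]
        refine (SimpleGraph.edist_le q).trans ?_
        simp at hq
        simp [hq]
  · rintro (h | ⟨w, h, hadj⟩)
    · exact h.trans (by norm_cast; omega)
    · refine SimpleGraph.edist_triangle.trans ((add_le_add h
        (SimpleGraph.edist_eq_one_iff_adj.2 hadj).le).trans ?_)
      norm_cast

/-- The matrices `3`, `4` and `5` describe the balls of radius `t`. -/
def DistInvariant (G : SimpleGraph (Fin N)) (t : ℕ) : Prop :=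
  ∀ i j, (0 < σ 3 i j ↔ G.edist i j ≤ t) ∧ (G.edist i j ≤ t → σ 4 i j = G.dist i j) ∧
    (¬ G.edist i j ≤ t → σ 4 i j = t) ∧ σ 5 i j = σ 4 i j % 2

theorem DistInvariant.step {σ : ℕ → Fin N → Fin N → ℤ} {G : SimpleGraph (Fin N)} {t : ℕ}
    (h : DistInvariant σ G t) (hA : ∀ i j, 0 < σ 2 i j ↔ G.Adj i j) :
    DistInvariant (distStep.exec σ) G (t + 1) := by
  intro i j
  obtain ⟨h3, h4, h5⟩ := exec_distStep σ i j
  obtain ⟨k1, k2, k3, k4⟩ := h i j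
  rw [h3, h4, h5]
  simp only [h i _, hA, ← edist_le_succ_iff]
  by_cases hle : G.edist i j ≤ t
  · have hle' : G.edist i j ≤ (t + 1 : ℕ) := hle.trans (by norm_cast; omega)
    simp only [hle, hle', if_true, k2 hle]
    simp
  · have hd : G.edist i j ≤ (t + 1 : ℕ) → (G.dist i j : ℤ) = t + 1 := by
      intro hle'
      have hr : G.Reachable i j := by
        rw [← SimpleGraph.edist_ne_top_iff_reachable]
        exact ne_top_of_le_ne_top (by simp) hle'
      rw [← hr.coe_dist_eq_edist] at hle hle'
      norm_cast at hle hle' ⊢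
      omega
    simp only [hle, if_false, k3 hle]
    refine ⟨?_, fun h => (hd h).symm, fun _ => by push_cast; rfl, ?_⟩
    · split_ifs with hh <;> simpa using hh
    · omega

/-- Shortest paths have fewer than `N` edges, so after `N` rounds the entry `N` marks exactly the
pairs in different components. -/
theorem distances_spec {σ : ℕ → Fin N → Fin N → ℤ} {G : SimpleGraph (Fin N)}
    (hA : ∀ i j, 0 < σ 2 i j ↔ G.Adj i j) (i j : Fin N) :
    (G.Reachable i j → distances.exec σ 4 i j = G.dist i j ∧ distances.exec σ 4 i j < N) ∧
    (distances.exec σ 4 i j < N → G.Reachable i j) ∧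
    distances.exec σ 5 i j = distances.exec σ 4 i j % 2 := by
  have key : ∀ t, DistInvariant (distStep.exec^[t] (distInit.exec σ)) G t ∧
      (distStep.exec^[t] (distInit.exec σ)) 2 = σ 2 := by
    intro t
    induction t with
    | zero =>
      refine ⟨fun i j => ?_, distInit.exec_of_notMem (by decide) σ⟩
      obtain ⟨h3, h4, h5⟩ := exec_distInit σ i j
      simp only [Function.iterate_zero, id, h3, h4, h5]
      by_cases hij : i = j
      · subst hij
        simp
      · simp [hij]
    | succ t ih =>
      rw [Function.iterate_succ_apply']
      exact ⟨ih.1.step (by simpa only [ih.2] using hA),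
        (distStep.exec_of_notMem (by decide) _).trans ih.2⟩
  obtain ⟨h1, h2, h3, h4⟩ := (key N).1 i j
  change (_ → (distStep.exec^[N] (distInit.exec σ)) 4 i j = _ ∧ _) ∧ _
  have hr : G.Reachable i j → G.dist i j < N := fun hr => by
    obtain ⟨p, hp, hl⟩ := hr.exists_path_of_dist
    have := hp.length_lt
    simp at this
    omega
  refine ⟨fun hij => ?_, fun hlt => ?_, h4⟩
  · have hle : G.edist i j ≤ N := by
      rw [← hij.coe_dist_eq_edist]
      exact_mod_cast (hr hij).le
    rw [h2 hle]
    exact ⟨rfl, (h2 hle).trans_lt (by exact_mod_cast hr hij)⟩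
  · by_contra hn
    have : ¬ G.edist i j ≤ N := by
      rw [SimpleGraph.edist_eq_top_of_not_reachable hn]
      simp
    exact absurd (h3 this) (by change (distStep.exec^[N] (distInit.exec σ)) 4 i j < N at hlt; omega)

end Algorithm

namespace Algorithm

open MExpr MProgram

variable {N : ℕ} [NeZero N] (σ : ℕ → Fin N → Fin N → ℤ)

/-! ### Cuts and their order -/

/-- The matrix `7` selects a neighbor for each vertex, which is nearer to the vertex `0` if
possible. -/
def parents : MProgram :=
  .seq (.fill 6 (ind (and (read 2 0 1) (or (lt (idx 0) (const 1)) (lt (read 4 9 1) (read 4 9 0))))))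
  (.fill 7 (ind (and (read 6 0 1) (not (any 2 (and (lt (idx 2) (idx 1)) (read 6 0 2)))))))

/-- The row `v` of the matrix `8` is the white side of the cut of the edge to the selected
neighbor. -/
def sides : MProgram :=
  .fill 8 (ind (any 2 (and (read 7 0 2)
    (cond (read 5 9 0) (lt (read 4 1 0) (read 4 1 2)) (lt (read 4 1 2) (read 4 1 0))))))

/-- The matrix `9` compares the rows of the matrix `8` by inclusion, and the matrix `10` refines
this preorder to a strict order. -/
def order : MProgram :=
  .seq (.fill 9 (ind (all 2 (or (not (read 8 0 2)) (read 8 1 2)))))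
  (.fill 10 (ind (and (read 9 0 1) (or (not (read 9 1 0)) (lt (idx 0) (idx 1))))))

theorem zero_lt_ite_iff (p : Prop) [Decidable p] : (0 : ℤ) < (if p then 1 else 0) ↔ p := by
  split_ifs with h <;> simp [h]

theorem exec_parents (i j : Fin N) :
    (0 < parents.exec σ 7 i j ↔
      (0 < σ 2 i j ∧ (i = 0 ∨ σ 4 0 j < σ 4 0 i)) ∧
        ∀ k < j, ¬ (0 < σ 2 i k ∧ (i = 0 ∨ σ 4 0 k < σ 4 0 i))) := by
  classical
  have h0 : ∀ i : Fin N, ((i : ℕ) : ℤ) < 1 ↔ i = 0 := fun i => by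
    rw [Fin.ext_iff, Fin.val_zero]
    omega
  simp [parents, exec, eval_ind, holds_and, holds_or, holds_not, holds_any, holds_lt, holds_read,
    eval, entryEnv_zero, entryEnv_one, entryEnv_nine, zero_lt_ite_iff, -Int.natCast_eq_zero, h0]

theorem exec_sides (v u : Fin N) :
    0 < sides.exec σ 8 v u ↔ ∃ q, 0 < σ 7 v q ∧
      if 0 < σ 5 0 v then σ 4 u v < σ 4 u q else σ 4 u q < σ 4 u v := by
  classical
  have hc : ∀ (b d e : MExpr) (ρ : ℕ → Fin N), (cond b d e).Holds σ ρ ↔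
      if b.Holds σ ρ then d.Holds σ ρ else e.Holds σ ρ := by
    intro b d e ρ
    rw [Holds, eval_cond]
    split_ifs <;> rfl
  simp [sides, exec, eval_ind, holds_and, hc, holds_any, holds_lt, holds_read,
    eval, entryEnv_zero, entryEnv_one, entryEnv_nine, zero_lt_ite_iff]

/-- Ties between equal rows are broken by the index. Copies of a cut thus form a chain and do not
increase the width. -/
theorem exec_order (i j : Fin N) :
    (0 < order.exec σ 9 i j ↔ ∀ u, 0 < σ 8 i u → 0 < σ 8 j u) ∧
    (0 < order.exec σ 10 i j ↔ (∀ u, 0 < σ 8 i u → 0 < σ 8 j u) ∧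
      (¬ (∀ u, 0 < σ 8 j u → 0 < σ 8 i u) ∨ i < j)) := by
  classical
  simp [order, exec, eval_ind, holds_and, holds_or, holds_not, holds_all, holds_lt, holds_read,
    eval, entryEnv_zero, entryEnv_one, zero_lt_ite_iff, imp_iff_not_or]

/-! ### The auction -/

/-- No element is matched, and all prices are zero. -/
def auctionInit : MProgram := .seq (.fill 11 (const 0)) (.fill 12 (const 0))

/-- The pairs that may be matched. -/
def enabled : MProgram :=
  .fill 13 (ind (and (read 10 0 1) (and (not (any 2 (read 11 0 2)))
    (and (lt (read 12 1 9) (add (sum 2 (const 1)) (const 2)))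
      (all 2 (or (not (read 10 0 2)) (not (lt (read 12 2 9) (read 12 1 9)))))))))

/-- The first pair that may be matched. -/
def selected : MProgram :=
  .fill 14 (ind (and (read 13 0 1) (not (any 2 (any 3 (and (read 13 2 3)
    (or (lt (idx 2) (idx 0)) (and (not (lt (idx 0) (idx 2))) (lt (idx 3) (idx 1))))))))))

/-- The selected pair is matched. -/
def bid : MProgram :=
  .seq (.fill 11 (cond (any 2 (read 14 2 1)) (ind (read 14 0 1)) (read 11 0 1)))
  (.fill 12 (cond (any 2 (read 14 2 0)) (add (read 12 0 1) (const 1)) (read 12 0 1)))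

/-- One step of the auction. -/
def auctionStep : MProgram := .seq enabled (.seq selected bid)

/-- The auction, with enough steps to reach a stable state. -/
def auction : MProgram := .seq auctionInit (.rep (.rep (.rep (.rep auctionStep))))

/-- The state of the auction. -/
def state : AuctionState (Fin N) := ⟨fun l r => 0 < σ 11 l r, fun r => σ 12 r 0⟩

theorem exec_enabled (l r : Fin N) : 0 < enabled.exec σ 13 l r ↔
    (state σ).Enabled (fun i j => 0 < σ 10 i j) (N + 2) l r := by
  classical
  simp [enabled, exec, eval_ind, holds_and, holds_or, holds_not, holds_all, holds_any, holds_lt,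
    holds_read, eval, entryEnv_zero, entryEnv_one, entryEnv_nine, zero_lt_ite_iff,
    AuctionState.Enabled, state, imp_iff_not_or]

/-- The lexicographically first enabled pair is selected, so that one step makes at most one bid. -/
theorem exec_selected (l r : Fin N) : 0 < selected.exec σ 14 l r ↔
    0 < σ 13 l r ∧ ∀ l' r', 0 < σ 13 l' r' → ¬ (l' < l ∨ (¬ l < l' ∧ r' < r)) := by
  classical
  simp [selected, exec, eval_ind, holds_and, holds_or, holds_not, holds_any, holds_lt,
    holds_read, eval, entryEnv_zero, entryEnv_one, zero_lt_ite_iff]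

theorem exec_bid (l r : Fin N) :
    (0 < bid.exec σ 11 l r ↔ if ∃ l', 0 < σ 14 l' r then 0 < σ 14 l r else 0 < σ 11 l r) ∧
    (bid.exec σ 12 l r = σ 12 l r + if ∃ l', 0 < σ 14 l' l then 1 else 0) := by
  classical
  constructor
  · simp [bid, exec, eval_ind, eval_cond, holds_any,
      holds_read, eval, entryEnv_zero, entryEnv_one]
    split_ifs <;> simp_all
  · simp [bid, exec, eval_ind, eval_cond, holds_any,
      holds_read, eval, entryEnv_zero, entryEnv_one]
    split_ifs <;> simp_all

theorem isStep_auctionStep :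
    (state σ).IsStep (fun i j => 0 < σ 10 i j) (N + 2) (state (auctionStep.exec σ)) := by
  classical
  set σ₁ := enabled.exec σ with hσ₁
  set σ₂ := selected.exec σ₁ with hσ₂
  have he : auctionStep.exec σ = bid.exec σ₂ := rfl
  have h11 : σ₂ 11 = σ 11 := by
    rw [hσ₂, selected.exec_of_notMem (by decide), hσ₁, enabled.exec_of_notMem (by decide)]
  have h12 : σ₂ 12 = σ 12 := by
    rw [hσ₂, selected.exec_of_notMem (by decide), hσ₁, enabled.exec_of_notMem (by decide)]
  have hsel : ∀ l r, 0 < σ₂ 14 l r ↔ 0 < σ₁ 13 l r ∧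
      ∀ l' r', 0 < σ₁ 13 l' r' → ¬ (l' < l ∨ (¬ l < l' ∧ r' < r)) := exec_selected σ₁
  by_cases hex : ∃ l r, 0 < σ₂ 14 l r
  · left
    obtain ⟨l, r, hlr⟩ := hex
    have huniq : ∀ l' r', 0 < σ₂ 14 l' r' ↔ l' = l ∧ r' = r := by
      intro l' r'
      refine ⟨fun h => ?_, fun h => h.1 ▸ h.2 ▸ hlr⟩
      have h1 := (hsel l r).1 hlr
      have h2 := (hsel l' r').1 h
      have h3 := h1.2 l' r' h2.1
      have h4 := h2.2 l r h1.1
      omega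
    refine ⟨l, r, (exec_enabled σ l r).1 ((hsel l r).1 hlr).1, ?_⟩
    rw [he]
    have hm : ∀ x y, (0 < bid.exec σ₂ 11 x y) = if y = r then x = l else 0 < σ 11 x y := by
      intro x y
      rw [eq_iff_iff, (exec_bid σ₂ x y).1]
      simp only [huniq, h11]
      by_cases hy : y = r <;> simp [hy]
    have hp : ∀ y, bid.exec σ₂ 12 y 0 = σ 12 y 0 + if y = r then 1 else 0 := by
      intro y
      rw [(exec_bid σ₂ y 0).2]
      simp only [huniq, h12]
      by_cases hy : y = r <;> simp [hy]
    simp only [state, AuctionState.bid, hm, hp]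
  · right
    have hno : ∀ l r, ¬ 0 < σ₁ 13 l r := by
      intro l r h
      obtain ⟨l₀, ⟨r₀, h₀⟩, hl₀⟩ := Set.exists_min_image {l | ∃ r, 0 < σ₁ 13 l r} id
        (Set.toFinite _) ⟨l, r, h⟩
      obtain ⟨r₁, h₁, hr₁⟩ := Set.exists_min_image {r | 0 < σ₁ 13 l₀ r} id
        (Set.toFinite _) ⟨r₀, h₀⟩
      refine hex ⟨l₀, r₁, (hsel l₀ r₁).2 ⟨h₁, fun l' r' h' => ?_⟩⟩
      have h2 : l₀ ≤ l' := hl₀ l' ⟨r', h'⟩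
      rintro (hlt | ⟨hlt, hr⟩)
      · omega
      · obtain rfl : l' = l₀ := by omega
        have h3 : r₁ ≤ r' := hr₁ r' h'
        omega
    refine ⟨fun l r h => hno l r ((exec_enabled σ l r).2 h), ?_⟩
    push Not at hex
    have hm : ∀ x y, (0 < bid.exec σ₂ 11 x y) = (0 < σ 11 x y) := by
      intro x y
      rw [eq_iff_iff, (exec_bid σ₂ x y).1, if_neg, h11]
      simpa using fun l => hex l y
    have hp : ∀ y, bid.exec σ₂ 12 y 0 = σ 12 y 0 := by
      intro y
      rw [(exec_bid σ₂ y 0).2, if_neg, h12, add_zero]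
      simpa using fun l => hex l y
    rw [he]
    simp only [state, hm, hp]

theorem auction_spec (hN : 2 ≤ N) :
    (state (auction.exec σ)).Invariant (fun i j => 0 < σ 10 i j) (N + 2) ∧
    ∀ l r, ¬ (state (auction.exec σ)).Enabled (fun i j => 0 < σ 10 i j) (N + 2) l r := by
  classical
  have hit : auction.exec σ = auctionStep.exec^[N * (N * (N * N))] (auctionInit.exec σ) := by
    simp only [auction, exec]
    rw [← Function.iterate_mul, ← Function.iterate_mul, ← Function.iterate_mul]
  rw [hit]
  have h10 : ∀ k, (auctionStep.exec^[k] (auctionInit.exec σ)) 10 = σ 10 := fun k => by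
    induction k with
    | zero => exact auctionInit.exec_of_notMem (by decide) σ
    | succ k ih =>
      rw [Function.iterate_succ_apply', auctionStep.exec_of_notMem (by decide), ih]
  refine AuctionState.stable_of_isStep
    (s := fun k => state (auctionStep.exec^[k] (auctionInit.exec σ))) ?_ (fun k => ?_) ?_
  · have : state (auctionInit.exec σ) = AuctionState.initial := by
      simp [state, AuctionState.initial, auctionInit, exec, eval]
    simp only [Function.iterate_zero, id, this]
    exact AuctionState.initial_invariant _ (by positivity)
  · have := isStep_auctionStep (auctionStep.exec^[k] (auctionInit.exec σ))
    simp only [h10] at this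
    simpa only [Function.iterate_succ_apply'] using this
  · simp only [Fintype.card_fin]
    push_cast
    -- The four nested repetitions give `N ^ 4` steps, more than the required `N * (N + 2)`; three
    -- would not be enough for `N = 2`.
    have h2 : (2 : ℤ) ≤ N := by exact_mod_cast hN
    have h4 : (4 : ℤ) ≤ N * N := by nlinarith
    nlinarith

/-! ### Chains -/

/-- The bottom elements of chains, and their number. -/
def roots : MProgram :=
  .seq (.fill 15 (ind (not (any 2 (read 11 2 0))))) (.fill 17 (sum 2 (ind (read 15 2 9))))

/-- Labels are passed upwards along the chains. -/
def labelStep : MProgram :=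
  .fill 16 (cond (read 15 0 9) (sum 2 (ind (and (lt (idx 2) (idx 0)) (read 15 2 9))))
    (sum 2 (cond (read 11 2 0) (read 16 2 1) (const 0))))

/-- The number of chains, and labels that tell the chains of the vertices. -/
def labels : MProgram := .seq roots (.rep labelStep)

open Classical in
theorem exec_roots (v j : Fin N) :
    (0 < roots.exec σ 15 v j ↔ ∀ l, ¬ (state σ).matched l v) ∧
    roots.exec σ 17 v j = (Finset.univ.filter fun r => ∀ l, ¬ (state σ).matched l r).card := by
  simp [roots, exec, eval_ind, holds_any, holds_not, holds_read, eval, entryEnv_zero,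
    entryEnv_nine, zero_lt_ite_iff, state]

open Classical in
theorem exec_labelStep (v j : Fin N) :
    labelStep.exec σ 16 v j = if 0 < σ 15 v 0 then
      ((Finset.univ.filter fun r => r < v ∧ 0 < σ 15 r 0).card : ℤ)
      else ∑ l, if 0 < σ 11 l v then σ 16 l j else 0 := by
  simp [labelStep, exec, eval_ind, eval_cond, holds_and, holds_lt, holds_read, eval,
    entryEnv_zero, entryEnv_one, entryEnv_nine]

end Algorithm

namespace Algorithm

open MExpr MProgram

variable {N : ℕ} [NeZero N] (σ : ℕ → Fin N → Fin N → ℤ)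

open Classical in
/-- The number of chains. -/
noncomputable def chainCount : ℕ :=
  (Finset.univ.filter fun r => ∀ l, ¬ (state σ).matched l r).card

-- Bottom elements are labelled by their rank among the bottom elements, so their labels are
-- distinct and less than their number. Every other element copies the label that its predecessor
-- had one round earlier.
variable {σ} in
theorem labels_spec {lt : Fin N → Fin N → Prop} {T : ℤ} (h : (state σ).Invariant lt T)
    (hirr : ∀ u, ¬ lt u u) (htr : ∀ u v w, lt u v → lt v w → lt u w) :
    (∀ l r, (state σ).matched l r → labels.exec σ 16 l 0 = labels.exec σ 16 r 0) ∧
    (∀ r r', (∀ l, ¬ (state σ).matched l r) → (∀ l, ¬ (state σ).matched l r') →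
      labels.exec σ 16 r 0 = labels.exec σ 16 r' 0 → r = r') ∧
    (∀ v, 0 ≤ labels.exec σ 16 v 0 ∧ labels.exec σ 16 v 0 < chainCount σ) ∧
    ∀ v j, labels.exec σ 17 v j = chainCount σ := by
  classical
  let R : Finset (Fin N) := Finset.univ.filter fun r => ∀ l, ¬ (state σ).matched l r
  let K : ℕ → Fin N → ℤ := fun t v => (labelStep.exec^[t] (roots.exec σ)) 16 v 0
  have hmem : ∀ v, v ∈ R ↔ ∀ l, ¬ (state σ).matched l v := by simp [R]
  have hframe : ∀ t a, a ≠ 16 →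
      (labelStep.exec^[t] (roots.exec σ)) a = roots.exec σ a := by
    intro t a ha
    induction t with
    | zero => rfl
    | succ t ih =>
      rw [Function.iterate_succ_apply',
        labelStep.exec_of_notMem (by simpa [labelStep, MProgram.writes] using ha), ih]
  have h11 : ∀ l r, 0 < roots.exec σ 11 l r ↔ (state σ).matched l r := fun l r => by
    rw [roots.exec_of_notMem (by decide)]
    rfl
  have hroot : ∀ t v, v ∈ R → K (t + 1) v = ((R.filter (· < v)).card : ℤ) := by
    intro t v hv
    simp only [K]
    rw [Function.iterate_succ_apply', exec_labelStep, hframe t 15 (by decide),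
      if_pos ((exec_roots σ v 0).1.2 ((hmem v).1 hv))]
    congr 2
    ext r
    simp only [Finset.mem_filter, Finset.mem_univ, true_and, (exec_roots σ r 0).1, hmem]
    tauto
  have hstep : ∀ t l v, (state σ).matched l v → K (t + 1) v = K t l := by
    intro t l v hlv
    simp only [K]
    rw [Function.iterate_succ_apply', exec_labelStep, hframe t 15 (by decide),
      hframe t 11 (by decide),
      if_neg (fun hc => (exec_roots σ v 0).1.1 hc l hlv), Finset.sum_eq_single l]
    · rw [if_pos ((h11 l v).2 hlv)]
    · intro l' _ hl'
      rw [if_neg]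
      intro hc
      exact hl' (h.left_unique _ _ _ ((h11 l' v).1 hc) hlv)
    · simp
  -- The number of elements below `v` bounds its position in its chain. Its label is settled after
  -- more than `ht v` rounds, and `ht v < N`.
  let ht : Fin N → ℕ := fun v => (Finset.univ.filter fun u => lt u v).card
  have hht : ∀ u v, lt u v → ht u < ht v := by
    intro u v huv
    refine Finset.card_lt_card ⟨fun x hx => ?_, fun hc => ?_⟩
    · simp only [Finset.mem_filter, Finset.mem_univ, true_and] at hx ⊢
      exact htr _ _ _ hx huv
    · have := hc (by simpa using huv : u ∈ _)
      simp [hirr] at this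
  have hhtN : ∀ v, ht v < N := by
    intro v
    have : ht v < (Finset.univ : Finset (Fin N)).card :=
      Finset.card_lt_card ⟨Finset.subset_univ _, fun hc => by
        have := hc (Finset.mem_univ v)
        simp [hirr] at this⟩
    simpa using this
  have key : ∀ t v, ht v < t → K (t + 1) v = K t v ∧ 0 ≤ K t v ∧ K t v < R.card := by
    intro t
    induction t with
    | zero => intro v hv; omega
    | succ t ih =>
      intro v hv
      by_cases hR : v ∈ R
      · rw [hroot _ v hR, hroot _ v hR]
        refine ⟨rfl, by positivity, ?_⟩
        exact_mod_cast Finset.card_lt_card ⟨Finset.filter_subset _ _, fun hc => by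
          have := hc hR
          simp at this⟩
      · rw [hmem] at hR
        push Not at hR
        obtain ⟨l, hl⟩ := hR
        rw [hstep _ l v hl, hstep _ l v hl]
        exact ih l (by have := hht l v (h.lt_of_matched l v hl); omega)
  have hK : ∀ v, labels.exec σ 16 v 0 = K N v := fun v => rfl
  simp only [hK]
  refine ⟨fun l r hlr => ?_, fun r r' hr hr' he => ?_, fun v => (key N v (hhtN v)).2, fun v j => ?_⟩
  · rw [← (key N r (hhtN r)).1, hstep N l r hlr]
  · rw [← (key N r (hhtN r)).1, ← (key N r' (hhtN r')).1, hroot N r ((hmem r).2 hr),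
      hroot N r' ((hmem r').2 hr')] at he
    by_contra hne
    wlog hlt : r < r' generalizing r r'
    · exact this r' r hr' hr he.symm (Ne.symm hne) (by omega)
    have : (R.filter (· < r)).card < (R.filter (· < r')).card := by
      refine Finset.card_lt_card ⟨fun x hx => ?_, fun hc => ?_⟩
      · simp only [Finset.mem_filter] at hx ⊢
        exact ⟨hx.1, hx.2.trans hlt⟩
      · have := hc (by simpa [hlt] using (hmem r).2 hr : r ∈ _)
        simp at this
    omega
  · change (labelStep.exec^[N] (roots.exec σ)) 17 v j = _
    rw [hframe N 17 (by decide), (exec_roots σ v j).2]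
    rfl

/-! ### Coordinates and their verification -/

/-- The matrix `18` selects one of the vertices that represent the same cut, and the matrix `19`
contains the coordinates. -/
def coordinates : MProgram :=
  .seq (.fill 18 (ind (not (any 2 (and (lt (idx 2) (idx 0)) (and (read 9 2 0) (read 9 0 2)))))))
  (.fill 19 (sum 2 (cond (and (read 18 2 9) (eq (read 16 2 9) (idx 1)))
    (sub (ind (read 8 2 0)) (ind (read 8 2 9))) (const 0))))

/-- The matrix `22` tells whether the coordinates define an isometric embedding. -/
def check : MProgram :=
  .seq (.fill 20 (sum 2 (read 19 0 2)))
  (.seq (.fill 21 (sum 2 (cond (lt (read 19 0 2) (read 19 1 2))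
    (sub (read 19 1 2) (read 19 0 2)) (sub (read 19 0 2) (read 19 1 2)))))
  (.fill 22 (ind (and (all 2 (and (lt (const (-1)) (read 20 2 9)) (lt (read 20 2 9) (const 2))))
    (all 2 (all 3 (and (lt (read 4 2 3) (sum 4 (const 1))) (eq (read 21 2 3) (read 4 2 3)))))))))

theorem exec_coordinates_rep (i : Fin N) : 0 < coordinates.exec σ 18 i 0 ↔
    ∀ j < i, ¬ (0 < σ 9 j i ∧ 0 < σ 9 i j) := by
  classical
  simp [coordinates, exec, eval_ind, holds_and, holds_not, holds_any, holds_lt, holds_read, eval,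
    entryEnv_zero, zero_lt_ite_iff]

open Classical in
theorem exec_coordinates (v j : Fin N) : coordinates.exec σ 19 v j =
    ∑ i, if 0 < coordinates.exec σ 18 i 0 ∧ σ 16 i 0 = ((j : ℕ) : ℤ) then
      (if 0 < σ 8 i v then 1 else 0) - (if 0 < σ 8 i 0 then 1 else 0) else 0 := by
  have h18 : ∀ i, coordinates.exec σ 18 i 0 = (MProgram.fill 18
      (ind (not (any 2 (and (lt (idx 2) (idx 0)) (and (read 9 2 0) (read 9 0 2))))))).exec σ 18 i 0 :=
    fun i => congrFun (congrFun (MProgram.exec_of_notMem (.fill 19 _) (by decide) _) i) 0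
  simp only [h18]
  rw [coordinates]
  simp only [exec]
  simp [eval_ind, eval_cond, holds_and, holds_eq, holds_read, eval,
    entryEnv_zero, entryEnv_one, entryEnv_nine]

open Classical in
theorem exec_check (i j : Fin N) : check.exec σ 22 i j =
    if (∀ v, 0 ≤ ∑ j, σ 19 v j ∧ ∑ j, σ 19 v j ≤ 1) ∧
      ∀ u v, σ 4 u v < N ∧ ∑ j, |σ 19 u j - σ 19 v j| = σ 4 u v then 1 else 0 := by
  have habs : ∀ x y : ℤ, |x - y| = if x < y then y - x else x - y := fun x y => by
    split_ifs with h
    · rw [abs_of_neg (by omega)]; ring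
    · rw [abs_of_nonneg (by omega)]
  have h1 : ∀ x : ℤ, -1 < x ↔ 0 ≤ x := fun x => by omega
  have h2 : ∀ x : ℤ, x < 2 ↔ x ≤ 1 := fun x => by omega
  simp [check, exec, eval_ind, eval_cond, holds_and, holds_all, holds_lt, holds_eq, eval,
    entryEnv_zero, entryEnv_one, entryEnv_nine, habs, h1, h2]

end Algorithm

/-! ### The complete algorithm and the relations between its matrices -/

namespace Algorithm

open MExpr MProgram

variable {N : ℕ} [NeZero N]

/-- The computation of the coordinates, with their verification. -/
def coordinatesCheck : MProgram := .seq coordinates check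

/-- The stages of the algorithm from the labels of the chains on. -/
def labelsCheck : MProgram := .seq labels coordinatesCheck

/-- The stages of the algorithm from the auction on. -/
def auctionCheck : MProgram := .seq auction labelsCheck

/-- The stages of the algorithm from the order of the cuts on. -/
def orderCheck : MProgram := .seq order auctionCheck

/-- The stages of the algorithm from the computation of the cuts on. -/
def sidesCheck : MProgram := .seq sides orderCheck

/-- The stages of the algorithm from the selection of neighbors on. -/
def parentsCheck : MProgram := .seq parents sidesCheck

/-- The whole algorithm, up to the output. -/
def main : MProgram := .seq distances parentsCheck

open Classical in
/-- The relations between the matrices that the algorithm computes for the graph `G`. -/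
structure Result (G : SimpleGraph (Fin N)) (σ : ℕ → Fin N → Fin N → ℤ) : Prop where
  dist : ∀ i j, G.Reachable i j → σ 4 i j = G.dist i j ∧ σ 4 i j < N
  reachable : ∀ i j, σ 4 i j < N → G.Reachable i j
  parity : ∀ i j, σ 5 i j = σ 4 i j % 2
  parent : ∀ i j, 0 < σ 7 i j ↔ (G.Adj i j ∧ (i = 0 ∨ σ 4 0 j < σ 4 0 i)) ∧
    ∀ k < j, ¬ (G.Adj i k ∧ (i = 0 ∨ σ 4 0 k < σ 4 0 i))
  side : ∀ v u, 0 < σ 8 v u ↔ ∃ q, 0 < σ 7 v q ∧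
      if 0 < σ 5 0 v then σ 4 u v < σ 4 u q else σ 4 u q < σ 4 u v
  sub : ∀ i j, 0 < σ 9 i j ↔ ∀ u, 0 < σ 8 i u → 0 < σ 8 j u
  lt : ∀ i j, 0 < σ 10 i j ↔ (∀ u, 0 < σ 8 i u → 0 < σ 8 j u) ∧
      (¬ (∀ u, 0 < σ 8 j u → 0 < σ 8 i u) ∨ i < j)
  invariant : (state σ).Invariant (fun i j => 0 < σ 10 i j) (N + 2)
  stable : ∀ l r, ¬ (state σ).Enabled (fun i j => 0 < σ 10 i j) (N + 2) l r
  label : ∀ l r, (state σ).matched l r → σ 16 l 0 = σ 16 r 0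
  label_root : ∀ r r', (∀ l, ¬ (state σ).matched l r) → (∀ l, ¬ (state σ).matched l r') →
      σ 16 r 0 = σ 16 r' 0 → r = r'
  label_bound : ∀ v, 0 ≤ σ 16 v 0 ∧ σ 16 v 0 < chainCount σ
  count : ∀ v j, σ 17 v j = chainCount σ
  rep : ∀ i, 0 < σ 18 i 0 ↔ ∀ j < i, ¬ (0 < σ 9 j i ∧ 0 < σ 9 i j)
  coord : ∀ v j, σ 19 v j = ∑ i, if 0 < σ 18 i 0 ∧ σ 16 i 0 = ((j : ℕ) : ℤ) then
      (if 0 < σ 8 i v then 1 else 0) - (if 0 < σ 8 i 0 then 1 else 0) else 0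
  ok : ∀ i j, σ 22 i j = if (∀ v, 0 ≤ ∑ j, σ 19 v j ∧ ∑ j, σ 19 v j ≤ 1) ∧
      ∀ u v, σ 4 u v < N ∧ ∑ j, |σ 19 u j - σ 19 v j| = σ 4 u v then 1 else 0

theorem lt_irrefl_of_rows {α β : Type*} [Preorder α] {lt : α → α → Prop} {M : α → β → Prop}
    (h : ∀ i j, lt i j ↔ (∀ u, M i u → M j u) ∧ (¬ (∀ u, M j u → M i u) ∨ i < j)) (i : α) :
    ¬ lt i i := by
  rw [h]
  rintro ⟨h1, h2 | h2⟩
  · exact h2 h1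
  · exact h2.false

theorem lt_trans_of_rows {α β : Type*} [Preorder α] {lt : α → α → Prop} {M : α → β → Prop}
    (h : ∀ i j, lt i j ↔ (∀ u, M i u → M j u) ∧ (¬ (∀ u, M j u → M i u) ∨ i < j)) (i j k : α)
    (hij : lt i j) (hjk : lt j k) : lt i k := by
  rw [h] at hij hjk ⊢
  refine ⟨fun u hu => hjk.1 u (hij.1 u hu), ?_⟩
  rcases hij.2 with h1 | h1
  · exact Or.inl fun hc => h1 fun u hu => hc u (hjk.1 u hu)
  · rcases hjk.2 with h2 | h2
    · exact Or.inl fun hc => h2 fun u hu => hij.1 u (hc u hu)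
    · exact Or.inr (h1.trans h2)

theorem result (hN : 2 ≤ N) {σ : ℕ → Fin N → Fin N → ℤ} {G : SimpleGraph (Fin N)}
    (hA : ∀ i j, 0 < σ 2 i j ↔ G.Adj i j) : Result G (main.exec σ) := by
  classical
  set σ₁ := distances.exec σ with h₁
  set σ₂ := parents.exec σ₁ with h₂
  set σ₃ := sides.exec σ₂ with h₃
  set σ₄ := order.exec σ₃ with h₄
  set σ₅ := auction.exec σ₄ with h₅
  set σ₆ := labels.exec σ₅ with h₆
  set σ₇ := coordinates.exec σ₆ with h₇
  have e₁ : main.exec σ = parentsCheck.exec σ₁ := rfl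
  have e₂ : main.exec σ = sidesCheck.exec σ₂ := rfl
  have e₃ : main.exec σ = orderCheck.exec σ₃ := rfl
  have e₄ : main.exec σ = auctionCheck.exec σ₄ := rfl
  have e₅ : main.exec σ = labelsCheck.exec σ₅ := rfl
  have e₆ : main.exec σ = coordinatesCheck.exec σ₆ := rfl
  have e₇ : main.exec σ = check.exec σ₇ := rfl
  set τ := main.exec σ
  -- Matrices that no later stage writes keep their values to the end, so the specification of every
  -- stage can be read in the final matrices `τ`.
  have f₁ : ∀ {a}, a ∉ parentsCheck.writes → σ₁ a = τ a := fun h => by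
    rw [e₁, exec_of_notMem _ h]
  have f₂ : ∀ {a}, a ∉ sidesCheck.writes → σ₂ a = τ a := fun h => by
    rw [e₂, exec_of_notMem _ h]
  have f₃ : ∀ {a}, a ∉ orderCheck.writes → σ₃ a = τ a := fun h => by
    rw [e₃, exec_of_notMem _ h]
  have f₄ : ∀ {a}, a ∉ auctionCheck.writes → σ₄ a = τ a := fun h => by
    rw [e₄, exec_of_notMem _ h]
  have f₅ : ∀ {a}, a ∉ labelsCheck.writes → σ₅ a = τ a := fun h => by
    rw [e₅, exec_of_notMem _ h]
  have f₆ : ∀ {a}, a ∉ coordinatesCheck.writes → σ₆ a = τ a := fun h => by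
    rw [e₆, exec_of_notMem _ h]
  have f₇ : ∀ {a}, a ∉ check.writes → σ₇ a = τ a := fun h => by
    rw [e₇, exec_of_notMem _ h]
  have hA' : ∀ i j, 0 < σ₁ 2 i j ↔ G.Adj i j := fun i j => by
    rw [h₁, distances.exec_of_notMem (by decide), hA]
  have hdist := fun i j => distances_spec hA i j
  rw [← h₁, f₁ (by decide), f₁ (by decide)] at hdist
  have hpar := exec_parents σ₁
  rw [← h₂, f₂ (by decide), f₁ (a := 4) (by decide)] at hpar
  simp only [hA'] at hpar
  have hside := exec_sides σ₂
  rw [← h₃, f₃ (by decide), f₂ (by decide), f₂ (by decide), f₂ (by decide)] at hside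
  have hord := exec_order σ₃
  rw [← h₄, f₄ (by decide), f₄ (by decide), f₃ (by decide)] at hord
  have hauc := auction_spec σ₄ hN
  have hst : state σ₅ = state τ := by
    simp only [state, f₅ (a := 11) (by decide), f₅ (a := 12) (by decide)]
  rw [← h₅, hst, f₄ (by decide)] at hauc
  have hlt := fun i j => (hord i j).2
  have hlab := labels_spec (σ := σ₅) (hst ▸ hauc.1)
    (lt_irrefl_of_rows (M := fun i u => 0 < τ 8 i u) hlt)
    (lt_trans_of_rows (M := fun i u => 0 < τ 8 i u) hlt)
  have hcc : chainCount σ₅ = chainCount τ := by simp only [chainCount, hst]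
  rw [hst, hcc, ← h₆, f₆ (by decide), f₆ (by decide)] at hlab
  have hrep := exec_coordinates_rep σ₆
  have hco := exec_coordinates σ₆
  rw [← h₇, f₇ (by decide), f₆ (by decide)] at hrep
  rw [← h₇, f₇ (by decide), f₇ (by decide), f₆ (by decide), f₆ (by decide)] at hco
  have hok := exec_check σ₇
  rw [← e₇, f₇ (by decide), f₇ (by decide)] at hok
  exact
    { dist := fun i j => (hdist i j).1
      reachable := fun i j => (hdist i j).2.1
      parity := fun i j => (hdist i j).2.2
      parent := hpar
      side := hside
      sub := fun i j => (hord i j).1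
      lt := hlt
      invariant := hauc.1
      stable := hauc.2
      label := hlab.1
      label_root := hlab.2.1
      label_bound := hlab.2.2.1
      count := hlab.2.2.2
      rep := hrep
      coord := hco
      ok := hok }

/-! ### Soundness and completeness of the algorithm -/

namespace Result

variable {G : SimpleGraph (Fin N)} {σ : ℕ → Fin N → Fin N → ℤ}

theorem comparable (h : Result G σ) {u v : Fin N} (huv : σ 16 u 0 = σ 16 v 0) :
    (∀ x, 0 < σ 8 u x → 0 < σ 8 v x) ∨ ∀ x, 0 < σ 8 v x → 0 < σ 8 u x := by
  rcases h.invariant.comparable (lt_irrefl_of_rows (M := fun i u => 0 < σ 8 i u) h.lt)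
    (lt_trans_of_rows (M := fun i u => 0 < σ 8 i u) h.lt) (κ := fun v => σ 16 v 0) h.label
    h.label_root huv with rfl | hlt | hlt
  · exact Or.inl fun _ hx => hx
  · exact Or.inl ((h.lt u v).1 hlt).1
  · exact Or.inr ((h.lt v u).1 hlt).1

theorem chainCount_pos (h : Result G σ) : 0 < chainCount σ := by
  have := h.label_bound 0
  omega

theorem chainCount_le : chainCount σ ≤ N :=
  (Finset.card_le_univ _).trans (Fintype.card_fin N).le

theorem coord_eq_zero (h : Result G σ) (v j : Fin N) (hj : chainCount σ ≤ (j : ℕ)) :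
    σ 19 v j = 0 := by
  rw [h.coord]
  refine Finset.sum_eq_zero fun i _ => if_neg fun hc => ?_
  have := h.label_bound i
  omega

omit [NeZero N] in
-- The algorithm stores `N` coordinates per vertex, but those from the number of chains on vanish.
theorem sum_coord {β : Type*} [AddCommMonoid β] (w : ℕ) (hw : w ≤ N) (F : Fin N → β)
    (hF : ∀ j : Fin N, w ≤ (j : ℕ) → F j = 0) : ∑ j, F j = ∑ j : Fin w, F (Fin.castLE hw j) := by
  classical
  refine Eq.trans ?_ (Finset.sum_map Finset.univ (Fin.castLEEmb hw) F)
  refine (Finset.sum_subset (Finset.subset_univ _) fun j _ hj => hF j ?_).symm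
  by_contra hlt
  exact hj (by simpa using ⟨⟨(j : ℕ), by omega⟩, by ext; rfl⟩)

/-- A positive answer is witnessed by the coordinates. -/
theorem isPlacement_of_ok (h : Result G σ) {k : ℕ} (hk : chainCount σ = k + 1)
    (hok : σ 22 0 0 = 1) (hkN : k + 1 ≤ N) : ∃ c : Fin N → Bool,
      IsPlacement G c fun v (j : Fin (k + 1)) => σ 19 v (Fin.castLE hkN j) := by
  rw [h.ok] at hok
  have hok : (∀ v, 0 ≤ ∑ j, σ 19 v j ∧ ∑ j, σ 19 v j ≤ 1) ∧
      ∀ u v, σ 4 u v < N ∧ ∑ j, |σ 19 u j - σ 19 v j| = σ 4 u v := by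
    by_contra hc
    rw [if_neg hc] at hok
    simp at hok
  refine ⟨fun v => decide (∑ j, σ 19 v j = 1), fun u v => h.reachable u v (hok.2 u v).1,
    fun u v => ?_, fun v => ?_⟩
  · rw [← (h.dist u v (h.reachable u v (hok.2 u v).1)).1, ← (hok.2 u v).2]
    refine sum_coord (k + 1) hkN _ fun j hj => ?_
    rw [h.coord_eq_zero u j (by omega), h.coord_eq_zero v j (by omega)]
    simp
  · rw [← sum_coord (k + 1) hkN (σ 19 v) fun j hj => h.coord_eq_zero v j (by omega)]
    have := hok.1 v
    simp only [decide_eq_true_eq]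
    split_ifs <;> omega

/-- The vertex zero has no neighbor nearer to itself; it gets its first neighbor, so that its row is
a cut as well. -/
theorem exists_parent (h : Result G σ) (hr : ∀ u v, G.Reachable u v) (hN : 2 ≤ N) (v : Fin N) :
    ∃ q, G.Adj v q ∧ (v ≠ 0 → G.dist 0 q < G.dist 0 v) ∧ ∀ q', 0 < σ 7 v q' ↔ q' = q := by
  have hnt : Nontrivial (Fin N) := Fin.nontrivial_iff_two_le.2 hN
  have hd : ∀ u v, σ 4 u v = G.dist u v := fun u v => (h.dist u v (hr u v)).1
  let S : Set (Fin N) := {q | G.Adj v q ∧ (v = 0 ∨ σ 4 0 q < σ 4 0 v)}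
  have hS : S.Nonempty := by
    by_cases hv : v = 0
    · obtain ⟨q, hq⟩ := exists_adj_of_reachable hr v
      exact ⟨q, hq, Or.inl hv⟩
    · have hpos := (hr v 0).pos_dist_of_ne hv
      obtain ⟨q, hq, hqd⟩ := exists_adj_dist_eq (G := G) (u := v) (v := 0) (n := G.dist v 0 - 1) (by omega)
      refine ⟨q, hq, Or.inr ?_⟩
      rw [hd, hd, SimpleGraph.dist_comm (u := 0), SimpleGraph.dist_comm (u := 0)]
      omega
  obtain ⟨q, hq, hmin⟩ := Set.exists_min_image S id (Set.toFinite _) hS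
  have huniq : ∀ q', 0 < σ 7 v q' ↔ q' = q := by
    intro q'
    rw [h.parent]
    constructor
    · rintro ⟨h1, h2⟩
      have h3 : q ≤ q' := hmin q' h1
      by_contra hne
      exact h2 q (lt_of_le_of_ne h3 (Ne.symm hne)) hq
    · rintro rfl
      refine ⟨hq, fun k hk hkS => ?_⟩
      have h3 : q' ≤ k := hmin k hkS
      omega
  refine ⟨q, hq.1, fun hv => ?_, huniq⟩
  have := hq.2.resolve_left hv
  rw [hd, hd] at this
  exact_mod_cast this

/-- For an isometric diamond subgraph, the rows of the matrix `8` are the cuts. -/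
theorem exists_coloring (h : Result G σ) (hN : 2 ≤ N) (hG : IsIsometricDiamondSubgraph G) :
    ∃ c : G.Coloring Bool, HasColoredCuts G c ∧ c 0 = false ∧
      Set.range (fun v => {u | 0 < σ 8 v u}) = cuts G c := by
  classical
  obtain ⟨k, hk⟩ := hG
  obtain ⟨c₀⟩ := nonempty_coloring hk
  have hr := reachable_of_embeds hk
  have hd : ∀ u v, σ 4 u v = G.dist u v := fun u v => (h.dist u v (hr u v)).1
  obtain ⟨f₀, hf₀⟩ := exists_isPlacement hk c₀
  -- The ends of an edge are never at the same distance from vertex zero, because the two sides of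
  -- the edge are complementary.
  have hcol : ∀ u v, G.Adj u v →
      decide (G.dist 0 u % 2 = 1) ≠ decide (G.dist 0 v % 2 = 1) := by
    intro u v huv he
    have h1 := hf₀.hasColoredCuts.notMem_side u v 0 huv
    have h2 := SimpleGraph.Adj.diff_dist_adj (u := 0) huv
    simp only [Diamond.side, Set.mem_ofPred_eq] at h1
    simp only [decide_eq_decide] at he
    omega
  let c : G.Coloring Bool := SimpleGraph.Coloring.mk _ fun {u v} => hcol u v
  have hc : ∀ v, c v = decide (G.dist 0 v % 2 = 1) := fun v => rfl
  -- The coloring by parity makes the vertex zero black, as is needed for the base vertex of the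
  -- coordinates.
  obtain ⟨f, hf⟩ := exists_isPlacement hk c
  have hcc := hf.hasColoredCuts
  have hrow : ∀ v q, (∀ q', 0 < σ 7 v q' ↔ q' = q) →
      {u | 0 < σ 8 v u} = if c v = true then Diamond.side G v q else Diamond.side G q v := by
    intro v q hq
    ext u
    have hp : 0 < σ 5 0 v ↔ c v = true := by
      rw [h.parity, hd, hc, decide_eq_true_iff]
      omega
    simp only [Set.mem_ofPred_eq, h.side, hq, exists_eq_left, hp, hd]
    split_ifs <;> simp [Diamond.side]
  refine ⟨c, hcc, by simp [hc], ?_⟩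
  ext C
  rw [hcc.mem_cuts]
  constructor
  · rintro ⟨v, rfl⟩
    obtain ⟨q, hadj, -, hq⟩ := h.exists_parent hr hN v
    cases hv : c v
    · exact ⟨q, v, hadj.symm, eq_true_of_adj hadj hv, by simp [hrow v q hq, hv]⟩
    · exact ⟨v, q, hadj, hv, by simp [hrow v q hq, hv]⟩
  · rintro ⟨p, q, hpq, hp, rfl⟩
    have hmem : Diamond.side G p q ∈ cuts G c := hcc.mem_cuts.2 ⟨p, q, hpq, hp, rfl⟩
    choose par hadj hlt hpar using h.exists_parent hr hN
    -- Every cut is crossed by an edge of the breadth-first tree: otherwise all vertices would lie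
    -- on the side of the vertex zero, but `p` and `q` are separated.
    obtain ⟨v, hv⟩ : ∃ v, ¬ (v ∈ Diamond.side G p q ↔ par v ∈ Diamond.side G p q) := by
      by_contra! hcon
      have hall : ∀ n v, G.dist 0 v = n → (v ∈ Diamond.side G p q ↔ 0 ∈ Diamond.side G p q) := by
        intro n
        induction n using Nat.strong_induction_on with
        | _ n ih =>
          intro v hv
          by_cases hv0 : v = 0
          · rw [hv0]
          · rw [hcon v]
            exact ih _ (hv ▸ hlt v hv0) _ rfl
      exact right_notMem_side p q ((hall _ q rfl).2 ((hall _ p rfl).1 (left_mem_side hpq)))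
    refine ⟨v, ?_⟩
    change {u | 0 < σ 8 v u} = _
    rw [hrow v (par v) (hpar v)]
    cases hcv : c v
    · rw [iff_comm, hcc.mem_iff_of_adj hmem (hadj v).symm (eq_true_of_adj (hadj v) hcv)] at hv
      simpa using (not_not.1 hv).symm
    · rw [hcc.mem_iff_of_adj hmem (hadj v) hcv] at hv
      simpa using (not_not.1 hv).symm

/-- The algorithm succeeds for isometric diamond subgraphs. -/
theorem ok_of_isIsometricDiamondSubgraph (h : Result G σ) (hN : 2 ≤ N)
    (hG : IsIsometricDiamondSubgraph G) :
    σ 22 0 0 = 1 ∧ chainCount σ = dimension G + 1 := by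
  classical
  obtain ⟨c, hcc, hc0, hrange⟩ := h.exists_coloring hN hG
  have hr := hcc.reachable
  have hd : ∀ u v, σ 4 u v = G.dist u v := fun u v => (h.dist u v (hr u v)).1
  have hnt : Nontrivial (Fin N) := Fin.nontrivial_iff_two_le.2 hN
  have hwN := chainCount_le (σ := σ)
  -- The first of each group of equal rows is kept, so the cuts are listed without repetition.
  let ι := {i : Fin N // 0 < σ 18 i 0}
  let C : ι → Set (Fin N) := fun i => {u | 0 < σ 8 i.1 u}
  have hinj : Function.Injective C := by
    rintro ⟨i, hi⟩ ⟨j, hj⟩ hij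
    have hij : ∀ u, 0 < σ 8 i u ↔ 0 < σ 8 j u := fun u => Set.ext_iff.1 hij u
    rw [h.rep] at hi hj
    simp only [h.sub] at hi hj
    rw [Subtype.mk_eq_mk]
    by_contra hne
    rcases lt_or_gt_of_ne hne with hlt | hlt
    · exact hj i hlt ⟨fun u => (hij u).1, fun u => (hij u).2⟩
    · exact hi j hlt ⟨fun u => (hij u).2, fun u => (hij u).1⟩
  have hrangeC : Set.range C = cuts G c := by
    rw [← hrange]
    ext D
    constructor
    · rintro ⟨i, rfl⟩
      exact ⟨i.1, rfl⟩
    · rintro ⟨v, rfl⟩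
      obtain ⟨i, hi, hmin⟩ := Set.exists_min_image
        {i : Fin N | ∀ u, 0 < σ 8 i u ↔ 0 < σ 8 v u} id (Set.toFinite _) ⟨v, fun u => Iff.rfl⟩
      refine ⟨⟨i, (h.rep i).2 fun j hj hsub => ?_⟩, Set.ext hi⟩
      rw [h.sub, h.sub] at hsub
      have : i ≤ j := hmin j fun u => ⟨fun hu => (hi u).1 (hsub.1 u hu),
        fun hu => hsub.2 u ((hi u).2 hu)⟩
      omega
  let κ : ι → Fin (chainCount σ) := fun i => ⟨(σ 16 i.1 0).toNat, by
    have := h.label_bound i.1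
    omega⟩
  have hκ : ∀ a b, κ a = κ b → C a ⊆ C b ∨ C b ⊆ C a := by
    intro a b hab
    refine h.comparable (u := a.1) (v := b.1) ?_
    have h1 := h.label_bound a.1
    have h2 := h.label_bound b.1
    simp only [κ, Fin.mk.injEq] at hab
    omega
  have hplace := hcc.isPlacement_chainCoord hinj hrangeC κ hκ hc0
  have hcoord : ∀ v j, chainCoord C κ 0 v j = σ 19 v (Fin.castLE hwN j) := by
    intro v j
    rw [chainCoord, finsum_eq_sum_of_fintype, h.coord]
    simp only [ite_and]
    refine Eq.trans ?_ (Finset.sum_filter (fun i => 0 < σ 18 i 0) _)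
    rw [Finset.sum_subtype _ (p := fun i => 0 < σ 18 i 0) (by simp)]
    refine Finset.sum_congr rfl fun i _ => ?_
    have hiff : κ i = j ↔ σ 16 i.1 0 = (((Fin.castLE hwN j : Fin N) : ℕ) : ℤ) := by
      have := h.label_bound i.1
      rw [Fin.ext_iff, Fin.val_castLE]
      change (σ 16 i.1 0).toNat = _ ↔ _
      omega
    have hC : ∀ v, v ∈ C i ↔ 0 < σ 8 i.1 v := fun _ => Iff.rfl
    simp only [hiff, hC]
  obtain ⟨w, hw⟩ := Nat.exists_eq_add_of_le' h.chainCount_pos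
  refine ⟨?_, le_antisymm ?_ ?_⟩
  · rw [h.ok, if_pos]
    refine ⟨fun v => ?_, fun u v => ⟨(h.dist u v (hr u v)).2, ?_⟩⟩
    · rw [sum_coord _ hwN _ fun j hj => h.coord_eq_zero v j hj]
      simp only [← hcoord, hplace.sum_eq]
      split_ifs <;> simp
    · rw [hd, hplace.dist_eq, sum_coord _ hwN _ fun j hj => by
        rw [h.coord_eq_zero u j hj, h.coord_eq_zero v j hj]; simp]
      simp only [hcoord]
  -- The antichain left by the auction bounds the number of chains by the width of the cuts, which
  -- is the dimension plus one.
  · obtain ⟨A, hA, hcard⟩ := h.invariant.exists_antichain (by simp) h.stable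
    have hmem : ∀ v, {u | 0 < σ 8 v u} ∈ cuts G c := fun v => hrange ▸ Set.mem_range_self v
    let F : Fin N → cuts G c := fun v => ⟨_, hmem v⟩
    -- If the cuts of `u` and `v` are nested, incomparability in the refined order forces the rows
    -- to be equal, and then the indices too.
    have hle : ∀ u ∈ A, ∀ v ∈ A, F u ≤ F v → u = v := by
      intro u hu v hv huv
      have huv : ∀ x, 0 < σ 8 u x → 0 < σ 8 v x := huv
      have h1 := hA u hu v hv
      have h2 := hA v hv u hu
      rw [h.lt] at h1 h2
      have h3 : (∀ x, 0 < σ 8 v x → 0 < σ 8 u x) ∧ ¬ u < v := by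
        by_contra hc
        exact h1 ⟨huv, by tauto⟩
      have h4 : ¬ v < u := fun hlt => h2 ⟨h3.1, Or.inr hlt⟩
      exact le_antisymm (not_lt.1 h4) (not_lt.1 h3.2)
    have hinjA : Set.InjOn F A := fun u hu v hv huv => hle u hu v hv huv.le
    have hanti : IsAntichain (· ≤ ·) (F '' A) := by
      rintro _ ⟨u, hu, rfl⟩ _ ⟨v, hv, rfl⟩ hne huv
      exact hne (by rw [hle u hu v hv huv])
    have h1 := le_iSup (fun A : {A : Set (cuts G c) // IsAntichain (· ≤ ·) A} => A.1.encard)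
      ⟨_, hanti⟩
    change _ ≤ width (cuts G c) at h1
    rw [← dimension_add_one_eq_width hG c] at h1
    simp only [hinjA.encard_image, Set.encard_coe_eq_coe_finsetCard] at h1
    have h2 : A.card ≤ dimension G + 1 := by exact_mod_cast h1
    rw [chainCount]
    convert hcard.trans h2
  -- Conversely, the computed coordinates are an embedding with one coordinate for each chain.
  · have hemb : Embeds G w := by
      refine IsPlacement.embeds (c := c)
        (f := fun v j => chainCoord C κ 0 v (Fin.cast hw.symm j)) ⟨hr, fun u v => ?_, fun v => ?_⟩
      · rw [hplace.dist_eq, ← (finCongr hw.symm).sum_comp]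
        rfl
      · rw [← hplace.sum_eq, ← (finCongr hw.symm).sum_comp]
        rfl
    have := dimension_le hemb
    omega

end Result
end Algorithm

/-! ### Output of the results and the two polynomial-time statements -/

namespace Algorithm

open MExpr MProgram

theorem inputMatrices_adj {n : ℕ} (G : SimpleGraph (Fin n)) (k : ℕ) (i j : Fin n) :
    0 < inputMatrices G k 2 i j ↔ G.Adj i j := by
  have hiff : (∃ u v : Fin n, ((i : ℕ) : ℤ) = (u : ℕ) ∧ ((j : ℕ) : ℤ) = (v : ℕ) ∧ G.Adj u v) ↔
      G.Adj i j := by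
    refine ⟨?_, fun h => ⟨i, j, rfl, rfl, h⟩⟩
    rintro ⟨u, v, hi, hj, h⟩
    obtain rfl : i = u := by omega
    obtain rfl : j = v := by omega
    exact h
  change 0 < input G k 2 _ _ ↔ _
  rw [input, if_neg (by simp), if_neg (by simp)]
  by_cases h : G.Adj i j
  · simpa only [if_pos (And.intro rfl (hiff.2 h)), h, iff_true] using one_pos
  · rw [if_neg fun hc => h (hiff.1 hc.2)]
    simpa using h

theorem inputMatrices_number {n : ℕ} [NeZero n] (G : SimpleGraph (Fin n)) (k : ℕ) :
    inputMatrices G k 1 0 0 = k := by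
  simp [inputMatrices, slot, input]

/-- The decision of whether the graph embeds into the diamond of the given dimension. -/
def test : MProgram :=
  .seq main (.fill 0 (ind (and (read 22 9 9) (lt (read 17 9 9) (add (read 1 9 9) (const 2))))))

/-- The output of the dimension and of the coordinates. -/
def embedding : MProgram :=
  .seq main (.seq (.fill 0 (ind (read 22 9 9))) (.seq (.fill 1 (sub (read 17 9 9) (const 1)))
    (.fill 2 (read 19 0 1))))

variable {N : ℕ} [NeZero N]

theorem exec_test (σ : ℕ → Fin N → Fin N → ℤ) (i j : Fin N) : test.exec σ 0 i j =
    if 0 < main.exec σ 22 0 0 ∧ main.exec σ 17 0 0 < σ 1 0 0 + 2 then 1 else 0 := by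
  have h1 : main.exec σ 1 = σ 1 := main.exec_of_notMem (by decide) σ
  simp only [test, exec, Function.update_self, eval_ind, holds_and, holds_lt, holds_read, eval,
    entryEnv_nine, h1]

theorem exec_embedding (σ : ℕ → Fin N → Fin N → ℤ) (i j : Fin N) :
    embedding.exec σ 0 i j = (if 0 < main.exec σ 22 0 0 then 1 else 0) ∧
    embedding.exec σ 1 i j = main.exec σ 17 0 0 - 1 ∧
    embedding.exec σ 2 i j = main.exec σ 19 i j := by
  classical
  simp [embedding, exec, eval_ind, holds_read, eval, entryEnv_nine, entryEnv_zero, entryEnv_one]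

/-- The outcome of the algorithm. -/
theorem main_spec (hN : 2 ≤ N) {σ : ℕ → Fin N → Fin N → ℤ} {G : SimpleGraph (Fin N)}
    (hA : ∀ i j, 0 < σ 2 i j ↔ G.Adj i j) :
    (0 < main.exec σ 22 0 0 ↔ IsIsometricDiamondSubgraph G) ∧
    (IsIsometricDiamondSubgraph G → main.exec σ 17 0 0 = dimension G + 1 ∧
      ∃ f : Fin N → Vertex (dimension G), IsIsometricEmbedding G (graph (dimension G)) f ∧
        ∀ (v j : Fin N) (i : Fin (dimension G + 1)), (j : ℕ) = i →
          main.exec σ 19 v j = (f v).1 i) := by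
  have h := result hN hA
  generalize main.exec σ = τ at h
  have hwN := Result.chainCount_le (σ := τ)
  refine ⟨⟨fun hok => ?_, fun hG => ?_⟩, fun hG => ?_⟩
  · obtain ⟨k, hk⟩ := Nat.exists_eq_add_of_le' h.chainCount_pos
    have hok1 : τ 22 0 0 = 1 := by
      have := h.ok 0 0
      split_ifs at this <;> omega
    obtain ⟨c, hc⟩ := h.isPlacement_of_ok hk hok1 (hk ▸ hwN)
    exact ⟨k, hc.embeds⟩
  · rw [(h.ok_of_isIsometricDiamondSubgraph hN hG).1]
    exact one_pos
  · obtain ⟨hok, hcount⟩ := h.ok_of_isIsometricDiamondSubgraph hN hG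
    obtain ⟨c, hc⟩ := h.isPlacement_of_ok hcount hok (hcount ▸ hwN)
    refine ⟨by rw [h.count, hcount]; push_cast; rfl,
      fun v => ⟨_, by rw [hc.sum_eq v]; split_ifs <;> simp⟩,
      hc.isIsometricEmbedding _ fun _ _ => rfl, fun v j i hij => ?_⟩
    have : j = Fin.castLE (hcount ▸ hwN) i := Fin.ext hij
    rw [this]

theorem isIsometricEmbedding_zero {n : ℕ} (hn : n < 2) (G : SimpleGraph (Fin n)) (k : ℕ) :
    IsIsometricEmbedding G (graph k) fun _ => ⟨fun _ => 0, by simp⟩ := by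
  intro u v
  obtain rfl : u = v := by omega
  simp

theorem polyTimeTest : PolyTimeTest := by
  obtain ⟨Q, b, hQ⟩ := test.exists_program
  refine ⟨Q, b, fun n k G => ?_⟩
  obtain ⟨τ, t, hr, ht, hsmall, hlarge⟩ := hQ n k G
  refine ⟨τ, t, hr, ht, ?_⟩
  rcases Nat.lt_or_ge n 2 with hn | hn
  · have hE : Embeds G k := ⟨_, isIsometricEmbedding_zero hn G k⟩
    exact ⟨fun _ => by rw [hsmall hn, set_self], fun h => absurd hE h⟩
  · have hnz : NeZero n := ⟨by omega⟩
    have hout : τ 0 0 0 = test.exec (inputMatrices G k) 0 0 0 := by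
      simpa [slot] using hlarge hnz hn 0 0 0
    rw [exec_test, inputMatrices_number] at hout
    obtain ⟨h1, h2⟩ := main_spec hn (inputMatrices_adj G k)
    rw [hout]
    -- The number of chains is the dimension plus one, so comparing it with `k + 2` tests whether
    -- the dimension is at most `k`.
    have key : (0 < main.exec (inputMatrices G k) 22 0 0 ∧
        main.exec (inputMatrices G k) 17 0 0 < (k : ℤ) + 2) ↔ Embeds G k := by
      rw [h1]
      refine ⟨fun ⟨hG, h3⟩ => ?_, fun h => ⟨⟨k, h⟩, ?_⟩⟩
      · rw [(h2 hG).1] at h3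
        exact (embeds_iff_dimension_le hG k).2 (by omega)
      · have := dimension_le h
        rw [(h2 ⟨k, h⟩).1]
        omega
    exact ⟨fun h => if_pos (key.2 h), fun h => if_neg (mt key.1 h)⟩

theorem polyTimeEmbedding : PolyTimeEmbedding := by
  obtain ⟨Q, b, hQ⟩ := embedding.exists_program
  refine ⟨Q, b, fun n G => ?_⟩
  obtain ⟨τ, t, hr, ht, hsmall, hlarge⟩ := hQ n 0 G
  refine ⟨τ, t, hr, ht, ?_⟩
  rcases Nat.lt_or_ge n 2 with hn | hn
  · have hE : Embeds G 0 := ⟨_, isIsometricEmbedding_zero hn G 0⟩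
    have hd : dimension G = 0 := Nat.le_zero.1 (dimension_le hE)
    refine ⟨fun h => absurd ⟨0, hE⟩ h, fun _ => ⟨by rw [hsmall hn, set_self], ?_,
      _, isIsometricEmbedding_zero hn G _, fun v i => ?_⟩⟩
    -- The rest of the input already is the output: the parameter zero is the dimension, and the
    -- zero adjacency matrix places a single vertex at the origin.
    · rw [hsmall hn, set_of_ne_array _ (by omega), hd]
      simp [input]
    · rw [hsmall hn, set_of_ne_array _ (by omega)]
      have : ¬ ∃ u w : Fin n, ((v : ℕ) : ℤ) = (u : ℕ) ∧ ((i : ℕ) : ℤ) = (w : ℕ) ∧ G.Adj u w := by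
        rintro ⟨u, w, -, -, hadj⟩
        obtain rfl : u = w := by omega
        exact G.loopless.irrefl _ hadj
      simp only [input, this]
      simp
  · have hnz : NeZero n := ⟨by omega⟩
    have hout : ∀ a < 3, ∀ i j : Fin n, τ a ((i : ℕ) : ℤ) ((j : ℕ) : ℤ) =
        embedding.exec (inputMatrices G 0) a i j := by
      intro a ha i j
      have := hlarge hnz hn a i j
      rwa [slot, if_pos ha] at this
    obtain ⟨h1, h2⟩ := main_spec hn (inputMatrices_adj G 0)
    have hz : ((0 : Fin n) : ℕ) = 0 := Fin.val_zero n
    have h00 := hout 0 (by omega) 0 0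
    have h10 := hout 1 (by omega) 0 0
    rw [(exec_embedding _ _ _).1, hz] at h00
    rw [(exec_embedding _ _ _).2.1, hz] at h10
    push_cast at h00 h10
    refine ⟨fun hG => ?_, fun hG => ?_⟩
    · rw [h00, if_neg (fun h => hG (h1.1 h))]
    · obtain ⟨h3, f, hf, hX⟩ := h2 hG
      refine ⟨by rw [h00, if_pos (h1.2 hG)], by rw [h10, h3]; omega, f, hf, fun v i => ?_⟩
      have hwN := Result.chainCount_le (σ := main.exec (inputMatrices G 0))
      have hw := ((result hn (inputMatrices_adj G 0)).ok_of_isIsometricDiamondSubgraph hn hG).2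
      have hi : (i : ℕ) < n := by omega
      have := hout 2 (by omega) v ⟨i, hi⟩
      rw [(exec_embedding _ _ _).2.2, hX v ⟨i, hi⟩ i rfl] at this
      exact this

end Algorithm
end Diamond

theorem theorem2 :
    (∀ (V : Type*) [Nontrivial V] (G : SimpleGraph V), Diamond.IsIsometricDiamondSubgraph G →
      Nonempty (G.Coloring Bool) ∧
      ∀ c : G.Coloring Bool,
        (∀ p q, G.Adj p q → ∃! C, Diamond.IsWhiteSide G c p q C) ∧
        (Diamond.dimension G : ℕ∞) + 1 = Diamond.width (Diamond.cuts G c)) ∧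
    Diamond.PolyTimeTest ∧ Diamond.PolyTimeEmbedding :=
  ⟨fun _ _ _ h => Diamond.cuts_and_dimension h, Diamond.Algorithm.polyTimeTest,
    Diamond.Algorithm.polyTimeEmbedding⟩
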